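/- **Theorem.** Let $\ell\subset(\mathbb C^\times)^n$ be a line, that is, a subvariety whose closure $\overline\ell\subset\mathbb P^n$ is a line. Let $E=\overline\ell\smallsetminus\ell$ be its (finite) set of ends, and let $|\ell|\subset\mathbb R_>^n$ be its algebraic amoeba, the image of $\ell$ under $x\mapsto(|x_1|,\dots,|x_n|)$. A circle in $\overline\ell$ is the image of $\mathbb P^1(\mathbb R)$ under a projective isomorphism $\mathbb P^1(\mathbb C)\to\overline\ell$; call $\ell$ *real* if $E$ lies on a circle and *complex* otherwise. Write $x_0=1,x_1,\dots,x_n$ for the homogeneous coordinates. Let $a\mathbb T_\ell\subset(\mathbb C^\times)^n$ be the set of points $x$ such that $x_i/x_j$ equals the constant value of this ratio on $\ell$ whenever the coordinates $x_i$ and $x_j$ vanish at a common end. Choose for each end $e$ a homogeneous coordinate $x_{\iota(e)}$ that vanishes at $e$; the $(x_{\iota(e)})_{e\in E}$ are homogeneous coordinates on $a\mathbb T_\ell$, and $k+1$ ends give a projection from $a\mathbb T_\ell$ to a coordinate torus $(\mathbb C^\times)^k$. Then the following hold. 1. $a\mathbb T_\ell$ is an affine subtorus (a translate of a subtorus) of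 dimension $|E|-1$ that contains $\ell$. 2. If $|E|=2$, then $\ell=a\mathbb T_\ell$, and $|\ell|$ is a rational affine line (under the identification $\mathbb R_>^n\simeq\mathbb R^n$ by the logarithm). 3. If $|E|=3$, then $\ell$ lies in no proper affine subtorus of $a\mathbb T_\ell$. If $X,Y,Z$ are the coordinates chosen for the three ends, then there are $a,b,c\in\mathbb C^\times$ such that $\ell$ is given in $a\mathbb T_\ell$ by $aX+bY+cZ=0$, and $|\ell|$ is the set of points of $|a\mathbb T_\ell|$ with $$|a||X|+|b||Y|\ge|c||Z|\quad\text{and}\quad\bigl||a||X|-|b||Y|\bigr|\le|c||Z|.\tag{$*$}$$ 4. Let $|E|\ge4$. If $\ell$ is complex, then $\ell\to|\ell|$ is a bijection. If $\ell$ is real, then $\ell\to|\ell|$ is injective on the points of $\ell$ on a circle that contains $E$, and two-to-one on the complement: the fibre through a point off the circle consists of exactly two points, both off the circle. 5. Let $|E|\ge4$ and let $\ell$ be real. There are $\binom{|E|}4$ quadratic hypersurfaces, one for each projection of $a\mathbb T_\ell$ to a coordinate $(\mathbb C^\times)^3$ (a quadratic form in exactly the four coordinates $x_{\iota(e)}$,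 $e\in F$, for each $F\subset E$ with $|F|=4$), whose intersection in $|a\mathbb T_\ell|$ is a surface that contains $|\ell|$, and $|\ell|$ is the subset of this surface on which the inequalities $(*)$ from all projections of $\ell$ to a coordinate $(\mathbb C^\times)^2$ hold. 6. Let $|E|\ge4$ and let $\ell$ be complex. Then some four ends do not lie on a circle, and $|\ell|$ is the intersection in $|a\mathbb T_\ell|$ of $A$ quadratic and $B$ quartic hypersurfaces (zero sets of nonzero forms of degree $2$ and $4$ in the coordinates $x_{\iota(e)}$, $e\in E$), where $A$ is the number of four-element subsets of $E$ that lie on a circle and $B$ the number of those that do not. They are indexed by the four-element subsets $F\subset E$, and, for any one prescribed $F_0$ that does not lie on a circle, they can be chosen such that for each $F\ne F_0$ the hypersurface comes from a projection of $a\mathbb T_\ell$ to a coordinate $(\mathbb C^\times)^3$: its form involves exactly the four coordinates $x_{\iota(e)}$, $e\in F$. -/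

import Mathlib

namespace LineAmoeba

open scoped LinearAlgebra.Projectivization

/-- The complex torus `(ℂ^×)^n`. -/
abbrev Torus (n : ℕ) : Type := Fin n → ℂˣ

/-- Complex projective space `ℙ^n`. -/
abbrev PSpace (n : ℕ) : Type := ℙ ℂ (Fin (n + 1) → ℂ)

/-- Homogeneous coordinates `(1, x₁, …, xₙ)` of a point of the torus. -/
def hom {n : ℕ} (x : Torus n) : Fin (n + 1) → ℂ := Fin.cons 1 (fun i => (x i : ℂ))

/-- Homogeneous coordinates `(1, r₁, …, rₙ)` of a point of `ℝ^n`. -/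
def homReal {n : ℕ} (r : Fin n → ℝ) : Fin (n + 1) → ℝ := Fin.cons 1 r

theorem hom_ne_zero {n : ℕ} (x : Torus n) : hom x ≠ 0 := by
  intro h
  have h0 := congrFun h 0
  simp [hom] at h0

/-- The inclusion `(ℂ^×)^n ⊂ ℙ^n`. -/
noncomputable def toP {n : ℕ} (x : Torus n) : PSpace n := Projectivization.mk ℂ (hom x) (hom_ne_zero x)

/-- The Zariski closure in `ℙ^n` of a subset of the torus: the common zeros of all the
homogeneous polynomials that vanish on it. -/
def projClosure {n : ℕ} (V : Set (Torus n)) : Set (PSpace n) :=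
  {p | ∀ (d : ℕ) (f : MvPolynomial (Fin (n + 1)) ℂ), f.IsHomogeneous d →
    (∀ x ∈ V, MvPolynomial.eval (hom x) f = 0) → MvPolynomial.eval p.rep f = 0}

/-- The projective line through the points `[u]` and `[v]`. -/
def projLine {n : ℕ} (u v : Fin (n + 1) → ℂ) : Set (PSpace n) :=
  {p | p.submodule ≤ Submodule.span ℂ {u, v}}

/-- `ℓ` is a line in the torus: a (Zariski closed) subvariety of the torus whose closure in
`ℙ^n` is a line. -/
def IsLine {n : ℕ} (ℓ : Set (Torus n)) : Prop :=
  (∀ x, toP x ∈ projClosure ℓ → x ∈ ℓ) ∧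
    ∃ u v : Fin (n + 1) → ℂ, LinearIndependent ℂ ![u, v] ∧ projClosure ℓ = projLine u v

/-- The set of ends of `ℓ`, the complement of `ℓ` in its closure. -/
def ends {n : ℕ} (ℓ : Set (Torus n)) : Set (PSpace n) := projClosure ℓ \ toP '' ℓ

/-- `C` is a circle on the projective line `closure ℓ ≃ ℙ¹(ℂ)` (circles and straight lines in
an affine chart): the image of `ℙ¹(ℝ)` under a projective isomorphism `ℙ¹(ℂ) ≃ closure ℓ`. -/
def IsCircle {n : ℕ} (ℓ : Set (Torus n)) (C : Set (PSpace n)) : Prop :=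
  ∃ u v : Fin (n + 1) → ℂ, LinearIndependent ℂ ![u, v] ∧ projClosure ℓ = projLine u v ∧
    C = {p | ∃ s t : ℝ, (s ≠ 0 ∨ t ≠ 0) ∧ (s : ℂ) • u + (t : ℂ) • v ∈ p.submodule}

/-- `ℓ` is real: its ends lie on a circle. -/
def IsRealLine {n : ℕ} (ℓ : Set (Torus n)) : Prop := ∃ C, IsCircle ℓ C ∧ ends ℓ ⊆ C

/-- `ℓ` is complex: its ends do not lie on a circle. -/
def IsComplexLine {n : ℕ} (ℓ : Set (Torus n)) : Prop := ¬ IsRealLine ℓ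

/-- The map `(ℂ^×)^n → ℝ_>^n` of coordinatewise absolute values. -/
noncomputable def absMap {n : ℕ} (x : Torus n) : Fin n → ℝ := fun i => ‖(x i : ℂ)‖

/-- The algebraic amoeba `|V|`. -/
def algAmoeba {n : ℕ} (V : Set (Torus n)) : Set (Fin n → ℝ) := absMap '' V

/-- `T` is an affine subtorus of dimension `d`: a translate of the subtorus on which the
characters in a saturated subgroup of rank `n - d` of the character lattice are trivial. -/
def IsAffineSubtorus {n : ℕ} (T : Set (Torus n)) (d : ℕ) : Prop :=
  ∃ M : AddSubgroup (Fin n → ℤ),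
    (∀ (k : ℤ) (m : Fin n → ℤ), k ≠ 0 → k • m ∈ M → m ∈ M) ∧
    Module.finrank ℤ M + d = n ∧
    ∃ a : Torus n, T = {x | ∀ m ∈ M, ∏ i, (x i / a i) ^ (m i) = 1}

/-- The affine subtorus `a𝕋_ℓ`: for each two homogeneous coordinates that vanish at a common end
of `ℓ`, the (constant) ratio of these coordinates on `ℓ` is imposed. -/
def affineTorus {n : ℕ} (ℓ : Set (Torus n)) : Set (Torus n) :=
  {x | ∀ i j : Fin (n + 1), (∃ e ∈ ends ℓ, e.rep i = 0 ∧ e.rep j = 0) →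
    ∀ y ∈ ℓ, hom x i * hom y j = hom x j * hom y i}

/-- A subset of `ℝ_>^n` that becomes, under the coordinatewise logarithm
`ℝ_>^n ≃ ℝ^n`, a line with a rational direction. -/
def IsRationalAffineLine {n : ℕ} (S : Set (Fin n → ℝ)) : Prop :=
  ∃ (v : Fin n → ℝ) (w : Fin n → ℤ), w ≠ 0 ∧
    (fun (r : Fin n → ℝ) (i : Fin n) => Real.log (r i)) '' S =
      {y | ∃ s : ℝ, ∀ i, y i = v i + s * (w i : ℝ)}

/-- A choice, for each end, of a homogeneous coordinate that vanishes there. Since coordinates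
that vanish at the same end are proportional on `a𝕋_ℓ`, these are homogeneous coordinates on
`a𝕋_ℓ`; its projections to coordinate tori `(ℂ^×)^k` are given by the `k + 1` homogeneous
coordinates that belong to `k + 1` different ends. -/
def IsEndCoordinate {n : ℕ} (ℓ : Set (Torus n)) (ι : ends ℓ → Fin (n + 1)) : Prop :=
  ∀ e : ends ℓ, (e : PSpace n).rep (ι e) = 0

/-- The inequalities `p + q ≥ r` and `|p - q| ≤ r`. -/
def TriangleIneq (p q r : ℝ) : Prop := r ≤ p + q ∧ |p - q| ≤ r

/-- The inequalities from all projections of `ℓ` to a coordinate `(ℂ^×)²`: if the image of `ℓ`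
is the line `a X + b Y + c Z = 0` then `|a||X|`, `|b||Y|`, `|c||Z|` satisfy the triangle
inequalities. -/
def PlanarInequalities {n : ℕ} (ℓ : Set (Torus n)) (ι : ends ℓ → Fin (n + 1))
    (r : Fin n → ℝ) : Prop :=
  ∀ e f g : ends ℓ, e ≠ f → e ≠ g → f ≠ g → ∀ a b c : ℂ, a ≠ 0 → b ≠ 0 → c ≠ 0 →
    (∀ x ∈ ℓ, a * hom x (ι e) + b * hom x (ι f) + c * hom x (ι g) = 0) →
    TriangleIneq (‖a‖ * homReal r (ι e)) (‖b‖ * homReal r (ι f)) (‖c‖ * homReal r (ι g))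

/-- The four-element sets of ends of `ℓ`. -/
abbrev FourEnds {n : ℕ} (ℓ : Set (Torus n)) : Type := {F : Finset (ends ℓ) // F.card = 4}

/-- The four ends lie on a circle. -/
def Concyclic {n : ℕ} {ℓ : Set (Torus n)} (F : FourEnds ℓ) : Prop :=
  ∃ C, IsCircle ℓ C ∧ ∀ e ∈ F.1, (e : PSpace n) ∈ C

/-- The points of `|a𝕋_ℓ|` on all the hypersurfaces `Q F = 0`, where each `Q F` is a form in the
homogeneous coordinates. -/
def cutOut {n : ℕ} (ℓ : Set (Torus n)) (Q : FourEnds ℓ → MvPolynomial (Fin (n + 1)) ℝ) :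
    Set (Fin n → ℝ) :=
  {r ∈ algAmoeba (affineTorus ℓ) | ∀ F, MvPolynomial.eval (homReal r) (Q F) = 0}

end LineAmoeba

open scoped LinearAlgebra.Projectivization
namespace LineAmoeba

/-! ### Points of projective space and their representatives -/

/-! Every homogeneous coordinate restricts to a nonzero linear form on the complex plane
(two-dimensional vector space) over the closure of ℓ. It therefore vanishes at exactly one end, and
coordinates with the same end are proportional on ℓ. Sorting the coordinates by their ends
(`IsLine.endOf`) shows that a𝕋_ℓ has one free homogeneous coordinate per end, which gives its
dimension.

Put three ends at ∞, 0, 1 (`Chart`). On the vector `s • w₁ + t • w₂` the coordinate of an end is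
then, up to a constant, t or s - z t, where z is the position of the end. The numbers |t|, |s|, |s -
t| are the sides of a triangle: they exist exactly under the triangle inequalities
(`exists_norm_eq_of_triangleIneq`), and they determine s/t up to complex conjugation
(`eq_or_eq_conj_of_norm_eq`). Conjugation keeps the distance from ξ to z only if ξ or z is real
(`norm_sub_eq_norm_conj_sub_iff`), whence the fibres over the amoeba.

For the equations, |s - z t|² = N - 2 Re(z̄ (P + iI)) + |z|² D is linear in the Hermitian matrix
with entries D = |t|², N = |s|², P + iI = s t̄, and such matrices satisfy ND = P² + I². For four
concyclic ends all z are real in a suitable chart, so I drops out, and four linear functions of (D,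
N, P) satisfy a linear relation: a quadric (`IsLine.exists_relation`). For four ends not on a circle
the four squares are coordinates on the Hermitian matrices, and ND = P² + I² becomes a quartic
(`IsLine.exists_quartic`).

If ℓ is real, the quadrics determine all squares from three of them, and the triangle inequalities
replace the missing I by P² ≤ ND. If ℓ is complex and F₀ is the only non-concyclic quadruple, then
F₀ = E and its quartic suffices. Otherwise the form of F₀ is taken to be a sum of squares of the
linear equations of the span of all vectors of squares (`exists_quartic_of_submodule`), and the
quartic of another non-concyclic quadruple imposes the rank-one condition. -/

theorem eval_smul_of_isHomogeneous {σ : Type*} {d : ℕ} {f : MvPolynomial σ ℂ}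
    (hf : f.IsHomogeneous d) (c : ℂ) (x : σ → ℂ) :
    MvPolynomial.eval (c • x) f = c ^ d * MvPolynomial.eval x f := by
  rw [MvPolynomial.eval_eq, MvPolynomial.eval_eq, Finset.mul_sum]
  refine Finset.sum_congr rfl fun m hm => ?_
  have hd : ∑ i ∈ m.support, m i = d := by
    have := hf (MvPolynomial.mem_support_iff.1 hm)
    simpa [Finsupp.weight_apply, Finsupp.sum] using this
  simp only [Pi.smul_apply, smul_eq_mul, mul_pow, Finset.prod_mul_distrib, Finset.prod_pow_eq_pow_sum,
    hd]
  ring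

theorem exists_smul_of_mem_submodule {V : Type*} [AddCommGroup V] [Module ℂ V] {p : ℙ ℂ V}
    {v w : V} (hv0 : v ≠ 0) (hv : v ∈ p.submodule) (hw : w ∈ p.submodule) : ∃ c : ℂ, w = c • v := by
  rw [Projectivization.submodule_eq, Submodule.mem_span_singleton] at hv hw
  obtain ⟨a, rfl⟩ := hv
  obtain ⟨b, rfl⟩ := hw
  have ha : a ≠ 0 := by rintro rfl; simp at hv0
  exact ⟨b / a, by rw [smul_smul, div_mul_cancel₀ _ ha]⟩

theorem eq_of_mem_submodule {V : Type*} [AddCommGroup V] [Module ℂ V] {p q : ℙ ℂ V}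
    {v : V} (hv0 : v ≠ 0) (hp : v ∈ p.submodule) (hq : v ∈ q.submodule) : p = q := by
  have key : ∀ r : ℙ ℂ V, v ∈ r.submodule → r = Projectivization.mk ℂ v hv0 := by
    intro r hr
    rw [Projectivization.submodule_eq, Submodule.mem_span_singleton] at hr
    obtain ⟨a, ha⟩ := hr
    rw [← Projectivization.mk_rep r, eq_comm, Projectivization.mk_eq_mk_iff']
    exact ⟨a, ha⟩
  rw [key p hp, key q hq]

theorem rep_mem_submodule {V : Type*} [AddCommGroup V] [Module ℂ V] (p : ℙ ℂ V) :
    p.rep ∈ p.submodule := by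
  rw [Projectivization.submodule_eq]; exact Submodule.mem_span_singleton_self _

theorem mem_submodule_mk {V : Type*} [AddCommGroup V] [Module ℂ V] {v : V} (hv : v ≠ 0) :
    v ∈ (Projectivization.mk ℂ v hv).submodule := by
  rw [Projectivization.submodule_mk]; exact Submodule.mem_span_singleton_self _

/-- `rep` is an arbitrary choice of representative; the vanishing of a coordinate does not depend on
it. -/
theorem rep_apply_eq_zero_iff {n : ℕ} {p : PSpace n} {v : Fin (n + 1) → ℂ} (hv0 : v ≠ 0)
    (hv : v ∈ p.submodule) (i : Fin (n + 1)) : p.rep i = 0 ↔ v i = 0 := by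
  obtain ⟨c, hc⟩ := exists_smul_of_mem_submodule hv0 hv (rep_mem_submodule p)
  have hc0 : c ≠ 0 := by rintro rfl; exact p.rep_nonzero (by simpa using hc)
  rw [hc]; simp [hc0]

theorem mem_projLine_iff {n : ℕ} {u v w : Fin (n + 1) → ℂ} {p : PSpace n} (hw0 : w ≠ 0)
    (hw : w ∈ p.submodule) : p ∈ projLine u v ↔ ∃ s t : ℂ, w = s • u + t • v := by
  have : p.submodule = Submodule.span ℂ {w} := by
    rw [eq_of_mem_submodule hw0 hw (mem_submodule_mk hw0), Projectivization.submodule_mk]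
  simp only [projLine, Set.mem_ofPred_eq, this, Submodule.span_singleton_le_iff_mem,
    Submodule.mem_span_pair, eq_comm]

theorem linearIndependent_pair_of_mem {V : Type*} [AddCommGroup V] [Module ℂ V] {p q : ℙ ℂ V}
    {v w : V} (hpq : p ≠ q) (hv0 : v ≠ 0) (hw0 : w ≠ 0) (hv : v ∈ p.submodule)
    (hw : w ∈ q.submodule) : LinearIndependent ℂ ![v, w] := by
  rw [LinearIndependent.pair_iff' hv0]
  intro a ha
  exact hpq (eq_of_mem_submodule hw0 (ha ▸ p.submodule.smul_mem a hv) hw)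

theorem projLine_congr {n : ℕ} {u v w₁ w₂ : Fin (n + 1) → ℂ}
    (hw : LinearIndependent ℂ ![w₁, w₂]) (h₁ : ∃ s t : ℂ, w₁ = s • u + t • v)
    (h₂ : ∃ s t : ℂ, w₂ = s • u + t • v) : projLine w₁ w₂ = projLine u v := by
  have hspan : Submodule.span ℂ {w₁, w₂} = Submodule.span ℂ {u, v} := by
    have hle : Submodule.span ℂ {w₁, w₂} ≤ Submodule.span ℂ {u, v} := by
      rw [Submodule.span_le]
      rintro w (rfl | rfl)
      · obtain ⟨s, t, h⟩ := h₁; exact Submodule.mem_span_pair.2 ⟨s, t, h.symm⟩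
      · obtain ⟨s, t, h⟩ := h₂; exact Submodule.mem_span_pair.2 ⟨s, t, h.symm⟩
    refine Submodule.eq_of_le_of_finrank_le hle ?_
    have h2 : Module.finrank ℂ (Submodule.span ℂ {w₁, w₂}) = 2 := by
      have := finrank_span_eq_card hw
      rwa [Matrix.range_cons_cons_empty, Fintype.card_fin] at this
    have h3 : Module.finrank ℂ (Submodule.span ℂ {u, v}) ≤ 2 := by
      have := finrank_range_le_card (R := ℂ) ![u, v]
      rwa [Set.finrank, Matrix.range_cons_cons_empty, Fintype.card_fin] at this
    omega
  simp only [projLine, hspan]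

/-! ### Lines in the torus -/

/-- The vectors `w₁`, `w₂` are a basis of the plane over the closure of `ℓ`. -/
structure Spans {n : ℕ} (ℓ : Set (Torus n)) (w₁ w₂ : Fin (n + 1) → ℂ) : Prop where
  li : LinearIndependent ℂ ![w₁, w₂]
  closure_eq : projClosure ℓ = projLine w₁ w₂

section Line

variable {n : ℕ} {ℓ : Set (Torus n)} {w₁ w₂ : Fin (n + 1) → ℂ}

@[simp] theorem hom_zero (x : Torus n) : hom x 0 = 1 := rfl

@[simp] theorem homReal_zero (r : Fin n → ℝ) : homReal r 0 = 1 := rfl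

@[simp] theorem hom_succ (x : Torus n) (i : Fin n) : hom x i.succ = x i := rfl

@[simp] theorem homReal_succ (r : Fin n → ℝ) (i : Fin n) : homReal r i.succ = r i := rfl

theorem hom_apply_ne_zero (x : Torus n) (i : Fin (n + 1)) : hom x i ≠ 0 := by
  refine Fin.cases ?_ (fun j => ?_) i <;> simp

theorem hom_injective : Function.Injective (hom (n := n)) := by
  intro x y h
  funext i
  exact Units.ext (by simpa using congrFun h i.succ)

theorem homReal_absMap (x : Torus n) (i : Fin (n + 1)) : homReal (absMap x) i = ‖hom x i‖ := by
  refine Fin.cases ?_ (fun j => ?_) i <;> simp [absMap]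

theorem homReal_injective : Function.Injective (homReal (n := n)) := by
  intro x y h
  funext i
  simpa using congrFun h i.succ

theorem exists_torus_hom_eq {v : Fin (n + 1) → ℂ} (hv : ∀ i, v i ≠ 0) :
    ∃ x : Torus n, hom x = (v 0)⁻¹ • v := by
  refine ⟨fun i => Units.mk0 (v i.succ / v 0) (div_ne_zero (hv _) (hv _)), ?_⟩
  funext i
  refine Fin.cases ?_ (fun j => ?_) i
  · simp [hv]
  · simp [div_eq_inv_mul]

theorem hom_mem_toP (x : Torus n) : hom x ∈ (toP x).submodule := mem_submodule_mk _

theorem toP_mem_projClosure {x : Torus n} (hx : x ∈ ℓ) : toP x ∈ projClosure ℓ := by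
  intro d f hf h
  obtain ⟨c, hc⟩ := exists_smul_of_mem_submodule (hom_ne_zero x) (hom_mem_toP x)
    (rep_mem_submodule (toP x))
  rw [hc, eval_smul_of_isHomogeneous hf, h x hx, mul_zero]

theorem IsLine.exists_spans (hℓ : IsLine ℓ) : ∃ w₁ w₂, Spans ℓ w₁ w₂ := by
  obtain ⟨_, u, v, h1, h2⟩ := hℓ
  exact ⟨u, v, h1, h2⟩

/-- Since ℓ is Zariski closed in the torus, it is all of the torus part of its closure, so
membership becomes linear algebra. -/
theorem IsLine.mem_iff (hℓ : IsLine ℓ) (h : Spans ℓ w₁ w₂) {x : Torus n} :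
    x ∈ ℓ ↔ ∃ s t : ℂ, hom x = s • w₁ + t • w₂ := by
  rw [← mem_projLine_iff (hom_ne_zero x) (hom_mem_toP x), ← h.closure_eq]
  exact ⟨toP_mem_projClosure, hℓ.1 x⟩

theorem IsLine.nonempty (hℓ : IsLine ℓ) : ℓ.Nonempty := by
  by_contra hne
  rw [Set.not_nonempty_iff_eq_empty] at hne
  obtain ⟨u, v, h⟩ := hℓ.exists_spans
  have hu : u ≠ 0 := by simpa using h.li.ne_zero 0
  have : Projectivization.mk ℂ u hu ∈ projClosure ℓ := by
    rw [h.closure_eq, mem_projLine_iff hu (mem_submodule_mk hu)]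
    exact ⟨1, 0, by simp⟩
  -- The constant form 1 vanishes vacuously on the empty set, so the closure of the empty set has no
  -- points.
  simpa using this 0 1 (MvPolynomial.isHomogeneous_one _ _) (by simp [hne])

theorem Spans.smul_add_smul_ne_zero (h : Spans ℓ w₁ w₂) {s t : ℂ} (hst : s ≠ 0 ∨ t ≠ 0) :
    s • w₁ + t • w₂ ≠ 0 := by
  intro h0
  have := LinearIndependent.pair_iff.1 h.li s t h0
  tauto

theorem Spans.mem_closure_iff (h : Spans ℓ w₁ w₂) {w : Fin (n + 1) → ℂ} {p : PSpace n}
    (hw0 : w ≠ 0) (hw : w ∈ p.submodule) :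
    p ∈ projClosure ℓ ↔ ∃ s t : ℂ, w = s • w₁ + t • w₂ := by
  rw [h.closure_eq, mem_projLine_iff hw0 hw]

theorem IsLine.coord_ne_zero (hℓ : IsLine ℓ) (h : Spans ℓ w₁ w₂) (i : Fin (n + 1)) :
    w₁ i ≠ 0 ∨ w₂ i ≠ 0 := by
  obtain ⟨x, hx⟩ := hℓ.nonempty
  obtain ⟨s, t, hst⟩ := (hℓ.mem_iff h).1 hx
  by_contra! hi
  exact hom_apply_ne_zero x i (by simp [hst, hi])

theorem IsLine.mem_ends_iff (hℓ : IsLine ℓ) {p : PSpace n} :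
    p ∈ ends ℓ ↔ p ∈ projClosure ℓ ∧ ∃ i, p.rep i = 0 := by
  refine and_congr_right fun hp => ?_
  constructor
  · intro hne
    by_contra! hi
    obtain ⟨x, hx⟩ := exists_torus_hom_eq hi
    have hxp : toP x = p := eq_of_mem_submodule (hom_ne_zero x) (hom_mem_toP x)
      (hx ▸ p.submodule.smul_mem _ (rep_mem_submodule p))
    exact hne ⟨x, hℓ.1 x (hxp ▸ hp), hxp⟩
  · rintro ⟨i, hi⟩ ⟨x, _, rfl⟩
    rw [rep_apply_eq_zero_iff (hom_ne_zero x) (hom_mem_toP x)] at hi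
    exact hom_apply_ne_zero x i hi

theorem IsLine.exists_end (hℓ : IsLine ℓ) (i : Fin (n + 1)) :
    ∃ e : ends ℓ, (e : PSpace n).rep i = 0 := by
  obtain ⟨w₁, w₂, h⟩ := hℓ.exists_spans
  -- This vector spans the kernel of the i-th coordinate on the plane.
  have hne : w₂ i • w₁ + (-w₁ i) • w₂ ≠ 0 := h.smul_add_smul_ne_zero (by
    have := hℓ.coord_ne_zero h i
    rw [neg_ne_zero]; tauto)
  have h0 := (rep_apply_eq_zero_iff hne (mem_submodule_mk hne) i).2 (by simp; ring)
  exact ⟨⟨Projectivization.mk ℂ _ hne, hℓ.mem_ends_iff.2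
    ⟨(h.mem_closure_iff hne (mem_submodule_mk hne)).2 ⟨_, _, rfl⟩, i, h0⟩⟩, h0⟩

theorem Spans.exists_rep (h : Spans ℓ w₁ w₂) {p : PSpace n} (hp : p ∈ projClosure ℓ) :
    ∃ s t : ℂ, (s ≠ 0 ∨ t ≠ 0) ∧ p.rep = s • w₁ + t • w₂ := by
  obtain ⟨s, t, hst⟩ := (h.mem_closure_iff p.rep_nonzero (rep_mem_submodule p)).1 hp
  refine ⟨s, t, ?_, hst⟩
  by_contra! h0
  exact p.rep_nonzero (by simp [hst, h0])

/-- Two coordinates that vanish at a common end are proportional on the plane over the line. -/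
theorem Spans.mul_eq_mul_of_rep_eq_zero (h : Spans ℓ w₁ w₂) {p : PSpace n}
    (hp : p ∈ projClosure ℓ) {i j : Fin (n + 1)} (hi : p.rep i = 0) (hj : p.rep j = 0) :
    w₁ i * w₂ j = w₁ j * w₂ i := by
  obtain ⟨s, t, hne, hst⟩ := h.exists_rep hp
  rw [hst] at hi hj
  simp only [Pi.add_apply, Pi.smul_apply, smul_eq_mul] at hi hj
  rcases hne with h0 | h0 <;> apply mul_left_cancel₀ h0
  · linear_combination w₂ j * hi - w₂ i * hj
  · linear_combination w₁ i * hj - w₁ j * hi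

/-- A nonzero linear form on a two-dimensional space has a one-dimensional kernel. -/
theorem IsLine.end_unique (hℓ : IsLine ℓ) {p q : PSpace n} (hp : p ∈ projClosure ℓ)
    (hq : q ∈ projClosure ℓ) {i : Fin (n + 1)} (hpi : p.rep i = 0) (hqi : q.rep i = 0) : p = q := by
  obtain ⟨w₁, w₂, h⟩ := hℓ.exists_spans
  obtain ⟨s, t, hne, hst⟩ := h.exists_rep hp
  obtain ⟨s', t', hne', hst'⟩ := h.exists_rep hq
  have h1 := hpi
  have h2 := hqi
  rw [hst] at h1
  rw [hst'] at h2
  simp only [Pi.add_apply, Pi.smul_apply, smul_eq_mul] at h1 h2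
  have hdet : s * t' = t * s' := by
    rcases hℓ.coord_ne_zero h i with h0 | h0 <;> apply mul_left_cancel₀ h0
    · linear_combination t' * h1 - t * h2
    · linear_combination s * h2 - s' * h1
  refine eq_of_mem_submodule q.rep_nonzero ?_ (rep_mem_submodule q)
  have hp' := rep_mem_submodule p
  rcases hne with h0 | h0
  · have : q.rep = (s' / s) • p.rep := by
      rw [hst, hst', smul_add, smul_smul, smul_smul]
      congr 2 <;> field_simp
      linear_combination hdet
    rw [this]; exact p.submodule.smul_mem _ hp'
  · have : q.rep = (t' / t) • p.rep := by
      rw [hst, hst', smul_add, smul_smul, smul_smul]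
      congr 2 <;> field_simp
      linear_combination -hdet
    rw [this]; exact p.submodule.smul_mem _ hp'

/-- The end at which a homogeneous coordinate vanishes. -/
noncomputable def IsLine.endOf (hℓ : IsLine ℓ) (i : Fin (n + 1)) : ends ℓ := (hℓ.exists_end i).choose

theorem IsLine.rep_endOf (hℓ : IsLine ℓ) (i : Fin (n + 1)) : (hℓ.endOf i : PSpace n).rep i = 0 :=
  (hℓ.exists_end i).choose_spec

theorem IsLine.endOf_eq_iff (hℓ : IsLine ℓ) {i : Fin (n + 1)} {e : ends ℓ} :
    hℓ.endOf i = e ↔ (e : PSpace n).rep i = 0 :=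
  ⟨fun h => h ▸ hℓ.rep_endOf i,
    fun h => Subtype.ext (hℓ.end_unique (hℓ.endOf i).2.1 e.2.1 (hℓ.rep_endOf i) h)⟩

theorem IsLine.endOf_surjective (hℓ : IsLine ℓ) : Function.Surjective hℓ.endOf := fun e => by
  obtain ⟨i, hi⟩ := (hℓ.mem_ends_iff.1 e.2).2
  exact ⟨i, hℓ.endOf_eq_iff.2 hi⟩

theorem IsLine.finite_ends (hℓ : IsLine ℓ) : Finite (ends ℓ) :=
  Finite.of_surjective _ hℓ.endOf_surjective

theorem IsLine.exists_isEndCoordinate (hℓ : IsLine ℓ) : ∃ ι, IsEndCoordinate ℓ ι := by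
  choose ι hι using hℓ.endOf_surjective
  exact ⟨ι, fun e => hℓ.endOf_eq_iff.1 (hι e)⟩

variable {ι : ends ℓ → Fin (n + 1)}

theorem IsLine.endOf_apply (hℓ : IsLine ℓ) (hι : IsEndCoordinate ℓ ι) (e : ends ℓ) :
    hℓ.endOf (ι e) = e := hℓ.endOf_eq_iff.2 (hι e)

theorem IsLine.endCoordinate_injective (hℓ : IsLine ℓ) (hι : IsEndCoordinate ℓ ι) :
    Function.Injective ι := Function.LeftInverse.injective (hℓ.endOf_apply hι)

theorem IsLine.rep_ne_zero (hℓ : IsLine ℓ) (hι : IsEndCoordinate ℓ ι) {e f : ends ℓ} (hef : e ≠ f) :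
    (e : PSpace n).rep (ι f) ≠ 0 := fun h =>
  hef ((hℓ.endOf_eq_iff.2 h).symm.trans (hℓ.endOf_apply hι f))

/-- On the plane over the line, two coordinates with the same end are proportional. -/
theorem IsLine.coord_mul_comm (hℓ : IsLine ℓ) (h : Spans ℓ w₁ w₂) {i j : Fin (n + 1)}
    (hij : hℓ.endOf i = hℓ.endOf j) (s t s' t' : ℂ) :
    (s * w₁ i + t * w₂ i) * (s' * w₁ j + t' * w₂ j) =
      (s * w₁ j + t * w₂ j) * (s' * w₁ i + t' * w₂ i) := by
  have := h.mul_eq_mul_of_rep_eq_zero (hℓ.endOf i).2.1 (hℓ.rep_endOf i)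
    (hij ▸ hℓ.rep_endOf j : ((hℓ.endOf i : ends ℓ) : PSpace n).rep j = 0)
  linear_combination (s * t' - t * s') * this

theorem IsLine.hom_mul_comm (hℓ : IsLine ℓ) {i j : Fin (n + 1)} (hij : hℓ.endOf i = hℓ.endOf j)
    {x y : Torus n} (hx : x ∈ ℓ) (hy : y ∈ ℓ) : hom x i * hom y j = hom x j * hom y i := by
  obtain ⟨w₁, w₂, h⟩ := hℓ.exists_spans
  obtain ⟨s, t, hst⟩ := (hℓ.mem_iff h).1 hx
  obtain ⟨s', t', hst'⟩ := (hℓ.mem_iff h).1 hy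
  have := hℓ.coord_mul_comm h hij s t s' t'
  simpa [hst, hst'] using this

/-- The prescribed ratios are constant on ℓ, so comparison with a single base point suffices. -/
theorem IsLine.mem_affineTorus_iff (hℓ : IsLine ℓ) {x y : Torus n} (hy : y ∈ ℓ) :
    x ∈ affineTorus ℓ ↔
      ∀ i j, hℓ.endOf i = hℓ.endOf j → hom x i * hom y j = hom x j * hom y i := by
  constructor
  · intro hx i j hij
    exact hx i j ⟨hℓ.endOf i, (hℓ.endOf i).2, hℓ.rep_endOf i, hij ▸ hℓ.rep_endOf j⟩ y hy
  · rintro hx i j ⟨e, he, hi, hj⟩ z hz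
    have hij : hℓ.endOf i = hℓ.endOf j := by
      exact ((hℓ.endOf_eq_iff (e := ⟨e, he⟩)).2 hi).trans ((hℓ.endOf_eq_iff (e := ⟨e, he⟩)).2 hj).symm
    have h1 := hx i j hij
    have h2 := hℓ.hom_mul_comm hij hy hz
    apply mul_right_cancel₀ (hom_apply_ne_zero y i)
    apply mul_right_cancel₀ (hom_apply_ne_zero y j)
    linear_combination hom z j * hom y i * h1 + hom x j * hom y i * h2

theorem IsLine.subset_affineTorus (hℓ : IsLine ℓ) : ℓ ⊆ affineTorus ℓ := fun _ hx =>
  (hℓ.mem_affineTorus_iff hx).2 fun _ _ _ => mul_comm _ _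

/-- A point of the affine torus whose chosen coordinates are those of a vector of the plane. -/
theorem IsLine.hom_eq_of_mem_affineTorus (hℓ : IsLine ℓ) (h : Spans ℓ w₁ w₂)
    (hι : IsEndCoordinate ℓ ι) {x : Torus n} (hx : x ∈ affineTorus ℓ) {s t : ℂ}
    (hst : ∀ e, hom x (ι e) = s * w₁ (ι e) + t * w₂ (ι e)) : hom x = s • w₁ + t • w₂ := by
  obtain ⟨y, hy⟩ := hℓ.nonempty
  obtain ⟨s', t', hst'⟩ := (hℓ.mem_iff h).1 hy
  funext i
  have hij : hℓ.endOf i = hℓ.endOf (ι (hℓ.endOf i)) := (hℓ.endOf_apply hι _).symm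
  have h1 := (hℓ.mem_affineTorus_iff hy).1 hx i _ hij
  have h2 := hℓ.coord_mul_comm h hij s t s' t'
  have hy' : ∀ j, hom y j = s' * w₁ j + t' * w₂ j := fun j => by simp [hst']
  rw [← hy', ← hy', ← hst] at h2
  apply mul_right_cancel₀ (hom_apply_ne_zero y (ι (hℓ.endOf i)))
  simp only [Pi.add_apply, Pi.smul_apply, smul_eq_mul]
  rw [h1, h2]

theorem homReal_pos_of_mem {V : Set (Torus n)} {r : Fin n → ℝ} (hr : r ∈ algAmoeba V)
    (i : Fin (n + 1)) : 0 < homReal r i := by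
  obtain ⟨x, _, rfl⟩ := hr
  rw [homReal_absMap]; exact norm_pos_iff.2 (hom_apply_ne_zero x i)

/-- A point of the amoeba of the affine torus whose chosen coordinates are the absolute values of
those of a vector of the plane lies in the amoeba of the line. -/
theorem IsLine.exists_mem_of_norm (hℓ : IsLine ℓ) (h : Spans ℓ w₁ w₂)
    (hι : IsEndCoordinate ℓ ι) {r : Fin n → ℝ} (hr : r ∈ algAmoeba (affineTorus ℓ)) {s t : ℂ}
    (hst : ∀ e, homReal r (ι e) = ‖s * w₁ (ι e) + t * w₂ (ι e)‖) :
    ∃ y ∈ ℓ, absMap y = r ∧ ∃ c : ℂ, c ≠ 0 ∧ hom y = c • (s • w₁ + t • w₂) := by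
  have hpos := homReal_pos_of_mem hr
  obtain ⟨x, hx, rfl⟩ := hr
  obtain ⟨a, ha⟩ := hℓ.nonempty
  obtain ⟨s', t', hst'⟩ := (hℓ.mem_iff h).1 ha
  have key : ∀ i, homReal (absMap x) i = ‖s * w₁ i + t * w₂ i‖ := by
    intro i
    have hij : hℓ.endOf i = hℓ.endOf (ι (hℓ.endOf i)) := (hℓ.endOf_apply hι _).symm
    have h1 := (hℓ.mem_affineTorus_iff ha).1 hx i _ hij
    have h2 := hℓ.coord_mul_comm h hij s t s' t'
    have ha' : ∀ j, hom a j = s' * w₁ j + t' * w₂ j := fun j => by simp [hst']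
    rw [← ha', ← ha'] at h2
    have h3 := congrArg norm h1
    have h4 := congrArg norm h2
    rw [norm_mul, norm_mul, ← homReal_absMap x, ← homReal_absMap x, hst (hℓ.endOf i), ← norm_mul,
      ← h4, norm_mul] at h3
    exact mul_right_cancel₀ (norm_ne_zero_iff.2 (hom_apply_ne_zero a _)) h3
  have hne : ∀ i, (s • w₁ + t • w₂) i ≠ 0 := fun i => by
    rw [← norm_pos_iff]
    simpa [key] using hpos i
  obtain ⟨y, hy⟩ := exists_torus_hom_eq hne
  -- Since r has zeroth homogeneous coordinate 1, normalizing the vector multiplies it by a number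
  -- of modulus 1 and keeps all absolute values.
  have h0 : ‖((s • w₁ + t • w₂) 0)⁻¹‖ = 1 := by
    have := key 0
    simp only [homReal_zero] at this
    simp [← this]
  refine ⟨y, (hℓ.mem_iff h).2 ⟨_, _, by rw [hy, smul_add, smul_smul, smul_smul]⟩, ?_,
    _, inv_ne_zero (hne 0), hy⟩
  apply homReal_injective
  funext i
  rw [homReal_absMap, hy, Pi.smul_apply, norm_smul, h0, one_mul, key]
  simp

theorem IsLine.mem_algAmoeba_iff (hℓ : IsLine ℓ) (h : Spans ℓ w₁ w₂)
    (hι : IsEndCoordinate ℓ ι) {r : Fin n → ℝ} (hr : r ∈ algAmoeba (affineTorus ℓ)) :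
    r ∈ algAmoeba ℓ ↔ ∃ s t : ℂ, ∀ e, homReal r (ι e) = ‖s * w₁ (ι e) + t * w₂ (ι e)‖ := by
  constructor
  · rintro ⟨x, hx, rfl⟩
    obtain ⟨s, t, hst⟩ := (hℓ.mem_iff h).1 hx
    exact ⟨s, t, fun e => by rw [homReal_absMap, hst]; simp⟩
  · rintro ⟨s, t, hst⟩
    obtain ⟨y, hy, hyr, _⟩ := hℓ.exists_mem_of_norm h hι hr hst
    exact ⟨y, hy, hyr⟩

/-- The chosen coordinates take arbitrary nonzero values on the affine torus. -/
theorem IsLine.exists_mem_affineTorus (hℓ : IsLine ℓ) (ι : ends ℓ → Fin (n + 1)) {a : Torus n}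
    (ha : a ∈ ℓ) (X : ends ℓ → ℂ) (hX : ∀ e, X e ≠ 0) :
    ∃ x ∈ affineTorus ℓ, ∃ c : ℂ, c ≠ 0 ∧ ∀ i,
      hom x i = c * (X (hℓ.endOf i) * (hom a i / hom a (ι (hℓ.endOf i)))) := by
  have hne : ∀ i, X (hℓ.endOf i) * (hom a i / hom a (ι (hℓ.endOf i))) ≠ 0 := fun i =>
    mul_ne_zero (hX _) (div_ne_zero (hom_apply_ne_zero _ _) (hom_apply_ne_zero _ _))
  obtain ⟨x, hx⟩ := exists_torus_hom_eq hne
  refine ⟨x, (hℓ.mem_affineTorus_iff ha).2 fun i j hij => ?_, _, inv_ne_zero (hne 0), fun i => ?_⟩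
  · rw [hx]
    simp only [Pi.smul_apply, smul_eq_mul, hij]
    ring
  · rw [hx]; rfl

end Line

/-! ### Projective coordinates with three ends at ∞, 0, 1, and circles through three ends. -/

section Charts

variable {n : ℕ} {ℓ : Set (Torus n)} {ι : ends ℓ → Fin (n + 1)} {e₁ e₂ e₃ : ends ℓ}

theorem IsLine.spans_of_mem {w₁ w₂ : Fin (n + 1) → ℂ} (hℓ : IsLine ℓ) {p q : PSpace n} (hpq : p ≠ q)
    (hp : p ∈ projClosure ℓ) (hq : q ∈ projClosure ℓ) (h₁ : w₁ ≠ 0) (h₂ : w₂ ≠ 0)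
    (hw₁ : w₁ ∈ p.submodule) (hw₂ : w₂ ∈ q.submodule) : Spans ℓ w₁ w₂ := by
  obtain ⟨u, v, h⟩ := hℓ.exists_spans
  have hli := linearIndependent_pair_of_mem hpq h₁ h₂ hw₁ hw₂
  exact ⟨hli, by rw [h.closure_eq, projLine_congr hli ((h.mem_closure_iff h₁ hw₁).1 hp)
    ((h.mem_closure_iff h₂ hw₂).1 hq)]⟩

/-- A coordinate on the closure of `ℓ` in which three ends are `∞`, `0` and `1`. -/
structure Chart (ℓ : Set (Torus n)) (e₁ e₂ e₃ : ends ℓ) where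
  w₁ : Fin (n + 1) → ℂ
  w₂ : Fin (n + 1) → ℂ
  spans : Spans ℓ w₁ w₂
  ne₁₂ : e₁ ≠ e₂
  ne₁₃ : e₁ ≠ e₃
  ne₂₃ : e₂ ≠ e₃
  mem₁ : w₁ ∈ (e₁ : PSpace n).submodule
  mem₂ : w₂ ∈ (e₂ : PSpace n).submodule
  mem₃ : w₁ + w₂ ∈ (e₃ : PSpace n).submodule
  z : ends ℓ → ℂ
  mem : ∀ e, e ≠ e₁ → z e • w₁ + w₂ ∈ (e : PSpace n).submodule

theorem IsLine.nonempty_chart (hℓ : IsLine ℓ) (h₁₂ : e₁ ≠ e₂) (h₁₃ : e₁ ≠ e₃) (h₂₃ : e₂ ≠ e₃) :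
    Nonempty (Chart ℓ e₁ e₂ e₃) := by
  have h := hℓ.spans_of_mem (fun h => h₁₂ (Subtype.ext h)) e₁.2.1 e₂.2.1
    (Projectivization.rep_nonzero _) (Projectivization.rep_nonzero _)
    (rep_mem_submodule (e₁ : PSpace n)) (rep_mem_submodule (e₂ : PSpace n))
  -- Both coefficients are nonzero because the ends are distinct; absorbing them into the basis
  -- vectors puts the third end at 1.
  obtain ⟨α, β, -, hαβ⟩ := h.exists_rep e₃.2.1
  have hα : α ≠ 0 := by
    rintro rfl
    refine h₂₃ (Subtype.ext (eq_of_mem_submodule (Projectivization.rep_nonzero _) ?_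
      (rep_mem_submodule (e₃ : PSpace n))))
    rw [hαβ, zero_smul, zero_add]
    exact Submodule.smul_mem _ _ (rep_mem_submodule _)
  have hβ : β ≠ 0 := by
    rintro rfl
    refine h₁₃ (Subtype.ext (eq_of_mem_submodule (Projectivization.rep_nonzero _) ?_
      (rep_mem_submodule (e₃ : PSpace n))))
    rw [hαβ, zero_smul, add_zero]
    exact Submodule.smul_mem _ _ (rep_mem_submodule _)
  have hm₁ := Submodule.smul_mem _ α (rep_mem_submodule (e₁ : PSpace n))
  have hm₂ := Submodule.smul_mem _ β (rep_mem_submodule (e₂ : PSpace n))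
  have h₁0 := smul_ne_zero hα (Projectivization.rep_nonzero (e₁ : PSpace n))
  have h₂0 := smul_ne_zero hβ (Projectivization.rep_nonzero (e₂ : PSpace n))
  have h' := hℓ.spans_of_mem (fun h => h₁₂ (Subtype.ext h)) e₁.2.1 e₂.2.1 h₁0 h₂0 hm₁ hm₂
  have hz : ∀ e : ends ℓ, ∃ z : ℂ, e ≠ e₁ →
      z • α • (e₁ : PSpace n).rep + β • (e₂ : PSpace n).rep ∈ (e : PSpace n).submodule := by
    intro e
    by_cases he : e = e₁
    -- A default value: the end at ∞ has no finite position, and the chart asks nothing of `z e₁`.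
    · exact ⟨0, fun h => absurd he h⟩
    obtain ⟨s, t, hne, hst⟩ := h'.exists_rep e.2.1
    have ht : t ≠ 0 := by
      rintro rfl
      refine he (Subtype.ext (eq_of_mem_submodule (Projectivization.rep_nonzero _)
        (rep_mem_submodule (e : PSpace n)) ?_))
      rw [hst, zero_smul, add_zero]
      exact Submodule.smul_mem _ _ hm₁
    refine ⟨s / t, fun _ => ?_⟩
    have := Submodule.smul_mem _ t⁻¹ (rep_mem_submodule (e : PSpace n))
    rw [hst, smul_add, smul_smul t⁻¹ s, smul_smul t⁻¹ t, inv_mul_cancel₀ ht, one_smul] at this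
    rwa [div_eq_inv_mul]
  choose z hz using hz
  exact ⟨⟨_, _, h', h₁₂, h₁₃, h₂₃, hm₁, hm₂, hαβ ▸ rep_mem_submodule (e₃ : PSpace n), z, hz⟩⟩

namespace Chart

variable (c : Chart ℓ e₁ e₂ e₃)

theorem w₁_ne_zero : c.w₁ ≠ 0 := by simpa using c.spans.li.ne_zero 0

theorem w₂_ne_zero : c.w₂ ≠ 0 := by simpa using c.spans.li.ne_zero 1

theorem smul_add_ne_zero (s : ℂ) : s • c.w₁ + c.w₂ ≠ 0 := by
  simpa using c.spans.smul_add_smul_ne_zero (s := s) (t := 1) (by simp)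

theorem eq_of_smul_mem {e : ends ℓ} {s : ℂ} (hs : s ≠ 0) (h : s • c.w₁ ∈ (e : PSpace n).submodule) :
    e = e₁ :=
  Subtype.ext (eq_of_mem_submodule c.w₁_ne_zero ((Submodule.smul_mem_iff _ hs).1 h) c.mem₁)

theorem z_eq_of_mem {e : ends ℓ} (he : e ≠ e₁) {s : ℂ}
    (h : s • c.w₁ + c.w₂ ∈ (e : PSpace n).submodule) : c.z e = s := by
  by_contra hne
  refine he (c.eq_of_smul_mem (sub_ne_zero.2 hne) ?_)
  have := Submodule.sub_mem _ (c.mem e he) h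
  rwa [add_sub_add_right_eq_sub, ← sub_smul] at this

theorem z₂ : c.z e₂ = 0 := c.z_eq_of_mem c.ne₁₂.symm (by simpa using c.mem₂)

theorem z₃ : c.z e₃ = 1 := c.z_eq_of_mem c.ne₁₃.symm (by simpa using c.mem₃)

theorem z_inj {e f : ends ℓ} (he : e ≠ e₁) (hf : f ≠ e₁) (h : c.z e = c.z f) : e = f :=
  Subtype.ext (eq_of_mem_submodule (c.smul_add_ne_zero _) (c.mem e he) (h ▸ c.mem f hf))

open Classical in
/-- The linear form on the plane over the line that vanishes at an end, in normal form. -/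
noncomputable def form (e : ends ℓ) (s t : ℂ) : ℂ := if e = e₁ then t else s - c.z e * t

open Classical in
/-- The constant by which a chosen coordinate differs from the normalized form. -/
noncomputable def κ (ι : ends ℓ → Fin (n + 1)) (e : ends ℓ) : ℂ :=
  if e = e₁ then c.w₂ (ι e) else c.w₁ (ι e)

theorem form_one (s t : ℂ) : c.form e₁ s t = t := if_pos rfl

theorem form_of_ne {e : ends ℓ} (he : e ≠ e₁) (s t : ℂ) : c.form e s t = s - c.z e * t := if_neg he

theorem form_two (s t : ℂ) : c.form e₂ s t = s := by
  rw [c.form_of_ne c.ne₁₂.symm, c.z₂]; ring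

theorem form_three (s t : ℂ) : c.form e₃ s t = s - t := by
  rw [c.form_of_ne c.ne₁₃.symm, c.z₃]; ring

theorem coord_of_rep_eq_zero {e : ends ℓ} {i : Fin (n + 1)} (hi : (e : PSpace n).rep i = 0)
    (s t : ℂ) : s * c.w₁ i + t * c.w₂ i =
      (open Classical in if e = e₁ then c.w₂ i else c.w₁ i) * c.form e s t := by
  by_cases he : e = e₁
  · subst he
    have := (rep_apply_eq_zero_iff c.w₁_ne_zero c.mem₁ i).1 hi
    rw [form_one, if_pos rfl, this]; ring
  · have := (rep_apply_eq_zero_iff (c.smul_add_ne_zero _) (c.mem e he) i).1 hi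
    simp only [Pi.add_apply, Pi.smul_apply, smul_eq_mul] at this
    rw [c.form_of_ne he, if_neg he]
    linear_combination t * this

theorem coord (hι : IsEndCoordinate ℓ ι) (e : ends ℓ) (s t : ℂ) :
    s * c.w₁ (ι e) + t * c.w₂ (ι e) = c.κ ι e * c.form e s t :=
  c.coord_of_rep_eq_zero (hι e) s t

theorem κ_ne_zero (hℓ : IsLine ℓ) (hι : IsEndCoordinate ℓ ι) (e : ends ℓ) : c.κ ι e ≠ 0 := by
  intro h
  have h₁ := c.coord hι e 1 0
  have h₂ := c.coord hι e 0 1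
  rw [h, zero_mul] at h₁ h₂
  have := hℓ.coord_ne_zero c.spans (ι e)
  simp at h₁ h₂
  tauto

theorem norm_coord_pos (hℓ : IsLine ℓ) (hι : IsEndCoordinate ℓ ι) (e : ends ℓ) :
    0 < ‖c.κ ι e‖ := norm_pos_iff.2 (c.κ_ne_zero hℓ hι e)

theorem hom_apply (hι : IsEndCoordinate ℓ ι) {x : Torus n} {s t : ℂ}
    (hx : hom x = s • c.w₁ + t • c.w₂) (e : ends ℓ) : hom x (ι e) = c.κ ι e * c.form e s t := by
  rw [hx, ← c.coord hι]; simp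

/-- The only circle through the three ends of the chart. -/
def circle : Set (PSpace n) :=
  {p | ∃ s t : ℝ, (s ≠ 0 ∨ t ≠ 0) ∧ (s : ℂ) • c.w₁ + (t : ℂ) • c.w₂ ∈ p.submodule}

theorem isCircle_circle : IsCircle ℓ c.circle :=
  ⟨c.w₁, c.w₂, c.spans.li, c.spans.closure_eq, rfl⟩

/-- A circle is the projectivization of a real form of the plane. The real vectors over the three
ends are multiples of w₁, w₂, w₁ + w₂, and the third one makes the first two multiples agree up to
real factors. Hence the real span of u, v is a complex multiple of that of w₁, w₂. -/
theorem eq_circle {C : Set (PSpace n)} (hC : IsCircle ℓ C) (h₁ : (e₁ : PSpace n) ∈ C)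
    (h₂ : (e₂ : PSpace n) ∈ C) (h₃ : (e₃ : PSpace n) ∈ C) : C = c.circle := by
  obtain ⟨u, v, hli, hcl, rfl⟩ := hC
  have huv : Spans ℓ u v := ⟨hli, hcl⟩
  obtain ⟨s₁, t₁, hne₁, hm₁⟩ := h₁
  obtain ⟨s₂, t₂, hne₂, hm₂⟩ := h₂
  obtain ⟨s₃, t₃, hne₃, hm₃⟩ := h₃
  have hw₃ : c.w₁ + c.w₂ ≠ 0 := by simpa using c.smul_add_ne_zero 1
  have hn : ∀ {s t : ℝ}, (s ≠ 0 ∨ t ≠ 0) → (s : ℂ) • u + (t : ℂ) • v ≠ 0 := fun h =>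
    huv.smul_add_smul_ne_zero (by simpa using h)
  obtain ⟨a, ha⟩ := exists_smul_of_mem_submodule (hn hne₁) hm₁ c.mem₁
  obtain ⟨b, hb⟩ := exists_smul_of_mem_submodule (hn hne₂) hm₂ c.mem₂
  obtain ⟨d, hd⟩ := exists_smul_of_mem_submodule hw₃ c.mem₃ hm₃
  have hd0 : d ≠ 0 := by rintro rfl; exact hn hne₃ (by simpa using hd)
  have ha0 : a ≠ 0 := by rintro rfl; exact c.w₁_ne_zero (by simpa using ha)
  have hb0 : b ≠ 0 := by rintro rfl; exact c.w₂_ne_zero (by simpa using hb)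
  have hli' := LinearIndependent.pair_iff.1 hli
  have hlin : (s₃ - d * (a * s₁ + b * s₂) : ℂ) • u + (t₃ - d * (a * t₁ + b * t₂) : ℂ) • v = 0 := by
    have h0 : (s₃ : ℂ) • u + (t₃ : ℂ) • v - d • (c.w₁ + c.w₂) = 0 := sub_eq_zero.2 hd
    rw [← h0, ha, hb]; module
  obtain ⟨hs, ht⟩ := hli' _ _ hlin
  -- If this determinant vanished, w₁ and w₂ would be proportional.
  have hδ : s₁ * t₂ - t₁ * s₂ ≠ 0 := by
    intro h0
    have h0' : (s₁ * t₂ - t₁ * s₂ : ℂ) = 0 := by exact_mod_cast h0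
    have := LinearIndependent.pair_iff.1 c.spans.li
    rcases hne₂ with h | h
    · have hz : (-(b * s₂) : ℂ) • c.w₁ + (a * s₁ : ℂ) • c.w₂ = 0 := by
        rw [ha, hb]
        have : (a * s₁ * b * t₂ - b * s₂ * a * t₁ : ℂ) • v = 0 := by
          rw [show (a * s₁ * b * t₂ - b * s₂ * a * t₁ : ℂ) = 0 by linear_combination a * b * h0']
          simp
        rw [← this]; module
      have := (this _ _ hz).1
      simp [hb0, h] at this
    · have hz : (-(b * t₂) : ℂ) • c.w₁ + (a * t₁ : ℂ) • c.w₂ = 0 := by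
        rw [ha, hb]
        have : (-(a * s₁ * b * t₂) + b * s₂ * a * t₁ : ℂ) • u = 0 := by
          rw [show (-(a * s₁ * b * t₂) + b * s₂ * a * t₁ : ℂ) = 0 by
            linear_combination -a * b * h0']
          simp
        rw [← this]; module
      have := (this _ _ hz).1
      simp [hb0, h] at this
  have hδ' : (s₁ * t₂ - t₁ * s₂ : ℂ) ≠ 0 := by exact_mod_cast hδ
  -- By Cramer's rule, `d * a` and `d * b` are quotients of real determinants, so they are real.
  set α : ℝ := (s₃ * t₂ - t₃ * s₂) / (s₁ * t₂ - t₁ * s₂) with hα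
  set β : ℝ := (s₁ * t₃ - t₁ * s₃) / (s₁ * t₂ - t₁ * s₂) with hβ
  have hda : d * a = α := by
    rw [hα]; push_cast
    rw [eq_div_iff hδ']; linear_combination -t₂ * hs + s₂ * ht
  have hdb : d * b = β := by
    rw [hβ]; push_cast
    rw [eq_div_iff hδ']; linear_combination -s₁ * ht + t₁ * hs
  have hα0 : α ≠ 0 := fun h => mul_ne_zero hd0 ha0 (by simpa [h] using hda)
  have hβ0 : β ≠ 0 := fun h => mul_ne_zero hd0 hb0 (by simpa [h] using hdb)
  have key : ∀ s t : ℝ, d • ((s : ℂ) • c.w₁ + (t : ℂ) • c.w₂) =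
      ((s * α * s₁ + t * β * s₂ : ℝ) : ℂ) • u + ((s * α * t₁ + t * β * t₂ : ℝ) : ℂ) • v := by
    intro s t
    rw [ha, hb]; push_cast
    rw [← hda, ← hdb]; module
  ext p
  constructor
  · rintro ⟨s, t, hst, hp⟩
    have h1 : ((s * t₂ - t * s₂) / (s₁ * t₂ - t₁ * s₂) / α) * α * s₁ +
        ((s₁ * t - t₁ * s) / (s₁ * t₂ - t₁ * s₂) / β) * β * s₂ = s := by
      rw [div_mul_cancel₀ _ hα0, div_mul_cancel₀ _ hβ0, div_mul_eq_mul_div, div_mul_eq_mul_div,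
        ← add_div, div_eq_iff hδ]
      ring
    have h2 : ((s * t₂ - t * s₂) / (s₁ * t₂ - t₁ * s₂) / α) * α * t₁ +
        ((s₁ * t - t₁ * s) / (s₁ * t₂ - t₁ * s₂) / β) * β * t₂ = t := by
      rw [div_mul_cancel₀ _ hα0, div_mul_cancel₀ _ hβ0, div_mul_eq_mul_div, div_mul_eq_mul_div,
        ← add_div, div_eq_iff hδ]
      ring
    refine ⟨(s * t₂ - t * s₂) / (s₁ * t₂ - t₁ * s₂) / α,
      (s₁ * t - t₁ * s) / (s₁ * t₂ - t₁ * s₂) / β, ?_, ?_⟩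
    · by_contra! h
      rw [h.1, h.2] at h1 h2
      simp only [zero_mul, add_zero] at h1 h2
      rcases hst with h | h
      · exact h h1.symm
      · exact h h2.symm
    · rw [← Submodule.smul_mem_iff _ hd0, key, h1, h2]; exact hp
  · rintro ⟨s, t, hst, hp⟩
    refine ⟨s * α * s₁ + t * β * s₂, s * α * t₁ + t * β * t₂, ?_, ?_⟩
    · by_contra! h
      have h1 : s * α * (s₁ * t₂ - t₁ * s₂) = 0 := by linear_combination t₂ * h.1 - s₂ * h.2
      have h2 : t * β * (s₁ * t₂ - t₁ * s₂) = 0 := by linear_combination s₁ * h.2 - t₁ * h.1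
      simp only [mul_eq_zero, hδ, hα0, hβ0, or_false] at h1 h2
      tauto
    · rw [← key]; exact Submodule.smul_mem _ _ hp

theorem mem_circle_one : (e₁ : PSpace n) ∈ c.circle := ⟨1, 0, by simp, by simpa using c.mem₁⟩

theorem mem_circle_two : (e₂ : PSpace n) ∈ c.circle := ⟨0, 1, by simp, by simpa using c.mem₂⟩

theorem mem_circle_three : (e₃ : PSpace n) ∈ c.circle := ⟨1, 1, by simp, by simpa using c.mem₃⟩

theorem mem_circle_iff_of_mem {p : PSpace n} {s t : ℂ} (ht : t ≠ 0)
    (hp : s • c.w₁ + t • c.w₂ ∈ p.submodule) : p ∈ c.circle ↔ (s / t).im = 0 := by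
  have hne : s • c.w₁ + t • c.w₂ ≠ 0 := c.spans.smul_add_smul_ne_zero (Or.inr ht)
  constructor
  · rintro ⟨a, b, hab, hm⟩
    obtain ⟨d, hd⟩ := exists_smul_of_mem_submodule hne hp hm
    have h0 : (a - d * s : ℂ) • c.w₁ + (b - d * t : ℂ) • c.w₂ = 0 := by
      have := sub_eq_zero.2 hd
      rw [← this]; module
    obtain ⟨h1, h2⟩ := LinearIndependent.pair_iff.1 c.spans.li _ _ h0
    have hd0 : d ≠ 0 := by
      rintro rfl
      simp at h1 h2
      tauto
    have : s / t = ((a / b : ℝ) : ℂ) := by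
      push_cast
      rw [sub_eq_zero.1 h1, sub_eq_zero.1 h2, mul_div_mul_left _ _ hd0]
    rw [this, Complex.ofReal_im]
  · intro h
    refine ⟨(s / t).re, 1, by simp, ?_⟩
    have : (((s / t).re : ℝ) : ℂ) = s / t := Complex.ext (by simp) (by simp [h])
    rw [this, ← Submodule.smul_mem_iff _ ht, smul_add, smul_smul, smul_smul, mul_div_cancel₀ _ ht]
    simpa using hp

theorem mem_circle_iff {e : ends ℓ} (he : e ≠ e₁) : (e : PSpace n) ∈ c.circle ↔ (c.z e).im = 0 := by
  have := c.mem_circle_iff_of_mem (p := e) (s := c.z e) (t := 1) one_ne_zero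
    (by simpa using c.mem e he)
  simpa using this

end Chart

theorem IsLine.circle_unique (hℓ : IsLine ℓ) (h₁₂ : e₁ ≠ e₂) (h₁₃ : e₁ ≠ e₃) (h₂₃ : e₂ ≠ e₃)
    {C C' : Set (PSpace n)} (hC : IsCircle ℓ C) (hC' : IsCircle ℓ C')
    (h₁ : (e₁ : PSpace n) ∈ C) (h₂ : (e₂ : PSpace n) ∈ C) (h₃ : (e₃ : PSpace n) ∈ C)
    (h₁' : (e₁ : PSpace n) ∈ C') (h₂' : (e₂ : PSpace n) ∈ C') (h₃' : (e₃ : PSpace n) ∈ C') :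
    C = C' := by
  obtain ⟨c⟩ := hℓ.nonempty_chart h₁₂ h₁₃ h₂₃
  rw [c.eq_circle hC h₁ h₂ h₃, c.eq_circle hC' h₁' h₂' h₃']

end Charts

/-! ### The affine torus and the characters that are constant on it. -/

section Tori

theorem prod_zpow_eq_zpow_sum {κ G : Type*} [CommGroup G] (s : Finset κ) (m : κ → ℤ) (a : G) :
    ∏ i ∈ s, a ^ m i = a ^ ∑ i ∈ s, m i := by
  classical
  induction s using Finset.induction_on with
  | empty => simp
  | insert i s hi ih => rw [Finset.prod_insert hi, Finset.sum_insert hi, ih, zpow_add]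

theorem prod_zpow_fiberwise {κ κ' G : Type*} [Fintype κ] [Fintype κ'] [DecidableEq κ'] [CommGroup G]
    (g : κ → κ') (m : κ → ℤ) (a : κ' → G) :
    ∏ i, a (g i) ^ m i = ∏ j, a j ^ ∑ i with g i = j, m i := by
  rw [← Finset.prod_fiberwise Finset.univ g]
  refine Finset.prod_congr rfl fun j _ => ?_
  rw [← prod_zpow_eq_zpow_sum]
  exact Finset.prod_congr rfl fun i hi => by rw [(Finset.mem_filter.1 hi).2]

variable {n : ℕ} {ℓ : Set (Torus n)} {ι : ends ℓ → Fin (n + 1)}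

/-- Relative to a base point of ℓ, a𝕋_ℓ becomes the subtorus of points whose coordinates depend only
on the end; x₀ = 1 fixes the value at the end of x₀. -/
theorem IsLine.mem_affineTorus_iff_exists (hℓ : IsLine ℓ) {x a : Torus n} (ha : a ∈ ℓ) :
    x ∈ affineTorus ℓ ↔ ∃ b : ends ℓ → ℂˣ, b (hℓ.endOf 0) = 1 ∧
      ∀ i : Fin n, x i / a i = b (hℓ.endOf i.succ) := by
  have hq : ∀ i, (((Fin.cons 1 (x / a) : Fin (n + 1) → ℂˣ) i : ℂˣ) : ℂ) = hom x i / hom a i := by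
    intro i
    refine Fin.cases ?_ (fun j => ?_) i <;> simp
  rw [hℓ.mem_affineTorus_iff ha]
  constructor
  · intro hx
    obtain ⟨ι, hι⟩ := hℓ.exists_isEndCoordinate
    have key : ∀ i, (Fin.cons 1 (x / a) : Fin (n + 1) → ℂˣ) (ι (hℓ.endOf i)) =
        (Fin.cons 1 (x / a) : Fin (n + 1) → ℂˣ) i := by
      intro i
      ext
      rw [hq, hq, div_eq_div_iff (hom_apply_ne_zero _ _) (hom_apply_ne_zero _ _)]
      exact hx _ _ (hℓ.endOf_apply hι _)
    exact ⟨fun e => (Fin.cons 1 (x / a) : Fin (n + 1) → ℂˣ) (ι e), (key 0).trans rfl,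
      fun i => (key i.succ).symm⟩
  · rintro ⟨b, hb0, hb⟩ i j hij
    have key : ∀ i, hom x i = b (hℓ.endOf i) * hom a i := by
      intro i
      refine Fin.cases ?_ (fun j => ?_) i
      · simp [hb0]
      · rw [← hb]; simp
    rw [key, key, hij]; ring

open Classical in
/-- The map of character lattices that sums the exponents over the coordinates with a given end. -/
noncomputable def IsLine.classSum (hℓ : IsLine ℓ) :
    (Fin n → ℤ) →ₗ[ℤ] ({e : ends ℓ // e ≠ hℓ.endOf 0} → ℤ) :=
  LinearMap.pi fun e => ∑ i with hℓ.endOf (Fin.succ i) = e.1, LinearMap.proj i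

open Classical in
theorem IsLine.classSum_apply (hℓ : IsLine ℓ) (m : Fin n → ℤ)
    (e : {e : ends ℓ // e ≠ hℓ.endOf 0}) :
    hℓ.classSum m e = ∑ i with hℓ.endOf (Fin.succ i) = e.1, m i := by
  simp [classSum]

theorem IsLine.exists_endOf_succ (hℓ : IsLine ℓ) {e : ends ℓ} (he : e ≠ hℓ.endOf 0) :
    ∃ i : Fin n, hℓ.endOf i.succ = e := by
  obtain ⟨j, rfl⟩ := hℓ.endOf_surjective e
  induction j using Fin.cases with
  | zero => exact absurd rfl he
  | succ i => exact ⟨i, rfl⟩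

theorem IsLine.classSum_surjective (hℓ : IsLine ℓ) : Function.Surjective hℓ.classSum := by
  classical
  intro k
  -- One coordinate from each class carries the whole prescribed sum.
  choose j hj using fun e : {e : ends ℓ // e ≠ hℓ.endOf 0} => hℓ.exists_endOf_succ e.2
  refine ⟨fun i => if h : hℓ.endOf i.succ = hℓ.endOf 0 then 0 else
    if j ⟨_, h⟩ = i then k ⟨_, h⟩ else 0, funext fun e => ?_⟩
  rw [hℓ.classSum_apply]
  have hje : (⟨hℓ.endOf (j e).succ, (hj e).symm ▸ e.2⟩ : {e // e ≠ hℓ.endOf 0}) = e :=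
    Subtype.ext (hj e)
  rw [Finset.sum_eq_single (j e)]
  · rw [dif_neg (by rw [hj e]; exact e.2), hje, if_pos rfl]
  · intro i hi hne
    have hi' := (Finset.mem_filter.1 hi).2
    rw [dif_neg (by rw [hi']; exact e.2), if_neg]
    intro h
    apply hne
    rw [← h]
    congr 1
    exact Subtype.ext hi'
  · intro h
    exact absurd (by simp [hj e]) h

theorem IsLine.prod_zpow_eq_one (hℓ : IsLine ℓ) {m : Fin n → ℤ} (hm : hℓ.classSum m = 0)
    {x a : Torus n} (ha : a ∈ ℓ) (hx : x ∈ affineTorus ℓ) : ∏ i, (x i / a i) ^ m i = 1 := by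
  classical
  have := hℓ.finite_ends
  have := Fintype.ofFinite (ends ℓ)
  obtain ⟨b, hb0, hb⟩ := (hℓ.mem_affineTorus_iff_exists ha).1 hx
  simp only [hb]
  rw [prod_zpow_fiberwise (fun i : Fin n => hℓ.endOf i.succ) m b]
  refine Finset.prod_eq_one fun e _ => ?_
  by_cases he : e = hℓ.endOf 0
  · rw [he, hb0, one_zpow]
  · rw [← hℓ.classSum_apply m ⟨e, he⟩, hm, Pi.zero_apply, zpow_zero]

theorem IsLine.classSum_single (hℓ : IsLine ℓ) (i : Fin n) (e) :
    hℓ.classSum (Pi.single i 1) e = (open Classical in if hℓ.endOf i.succ = e.1 then 1 else 0) := by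
  classical
  rw [hℓ.classSum_apply]
  simp [Pi.single_apply]

theorem IsLine.mem_affineTorus_of_prod (hℓ : IsLine ℓ) {x a : Torus n} (ha : a ∈ ℓ)
    (h : ∀ m, hℓ.classSum m = 0 → ∏ i, (x i / a i) ^ m i = 1) : x ∈ affineTorus ℓ := by
  classical
  have hsingle : ∀ i (k : ℤ) (y : Torus n), ∏ j, y j ^ (Pi.single i k : Fin n → ℤ) j = y i ^ k := by
    intro i k y
    rw [Finset.prod_eq_single i (fun j _ hj => by simp [hj]) (by simp)]
    simp
  -- Two kinds of characters suffice: x_i for i in the class of x₀, and x_i / x_j for i, j in a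
  -- common class.
  have h₀ : ∀ i : Fin n, hℓ.endOf i.succ = hℓ.endOf 0 → x i / a i = 1 := by
    intro i hi
    have := h (Pi.single i 1) (by
      funext e
      rw [hℓ.classSum_single, if_neg (by rw [hi]; exact e.2.symm)]; rfl)
    rwa [hsingle i 1 (fun i => x i / a i), zpow_one] at this
  have h₁ : ∀ i j : Fin n, hℓ.endOf i.succ = hℓ.endOf j.succ → x i / a i = x j / a j := by
    intro i j hij
    have := h (Pi.single i 1 - Pi.single j 1) (by
      rw [map_sub, sub_eq_zero]
      funext e
      rw [hℓ.classSum_single, hℓ.classSum_single, hij])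
    simp only [Pi.sub_apply, zpow_sub, Finset.prod_mul_distrib, Finset.prod_inv_distrib] at this
    rw [hsingle i 1 (fun i => x i / a i), hsingle j 1 (fun i => x i / a i), zpow_one, zpow_one,
      mul_inv_eq_one] at this
    exact this
  choose j hj using fun e : {e : ends ℓ // e ≠ hℓ.endOf 0} => hℓ.exists_endOf_succ e.2
  refine (hℓ.mem_affineTorus_iff_exists ha).2
    ⟨fun e => if he : e = hℓ.endOf 0 then 1 else x (j ⟨e, he⟩) / a (j ⟨e, he⟩), by simp,
      fun i => ?_⟩
  by_cases he : hℓ.endOf i.succ = hℓ.endOf 0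
  · simp only [he, dite_true]; exact h₀ i he
  · simp only [he, dite_false]; exact h₁ _ _ (hj ⟨_, he⟩).symm

/-- The lattice of trivial characters is the kernel of `classSum`. It is saturated because the
target is torsion-free, and its rank follows from surjectivity by rank-nullity. -/
theorem IsLine.isAffineSubtorus (hℓ : IsLine ℓ) :
    ∃ d : ℕ, d + 1 = (ends ℓ).ncard ∧ IsAffineSubtorus (affineTorus ℓ) d ∧ ℓ ⊆ affineTorus ℓ := by
  classical
  have := hℓ.finite_ends
  have := Fintype.ofFinite (ends ℓ)
  have hcard : Fintype.card {e : ends ℓ // e ≠ hℓ.endOf 0} + 1 = (ends ℓ).ncard := by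
    rw [← Nat.card_coe_set_eq, Nat.card_eq_fintype_card, Fintype.card_subtype_compl,
      Fintype.card_subtype_eq]
    exact Nat.sub_add_cancel (Fintype.card_pos_iff.2 ⟨hℓ.endOf 0⟩)
  refine ⟨_, hcard, ⟨(LinearMap.ker hℓ.classSum).toAddSubgroup, ?_, ?_, ?_⟩, hℓ.subset_affineTorus⟩
  · intro k m hk hm
    simp only [Submodule.mem_toAddSubgroup, LinearMap.mem_ker, map_smul] at hm ⊢
    exact (smul_eq_zero.1 hm).resolve_left hk
  · have h1 := (LinearMap.ker hℓ.classSum).finrank_quotient_add_finrank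
    rw [(LinearMap.quotKerEquivOfSurjective _ hℓ.classSum_surjective).finrank_eq,
      Module.finrank_fintype_fun_eq_card, Module.finrank_fintype_fun_eq_card, Fintype.card_fin] at h1
    exact (add_comm _ _).trans h1
  · obtain ⟨a, ha⟩ := hℓ.nonempty
    refine ⟨a, Set.ext fun x => ⟨fun hx m hm => hℓ.prod_zpow_eq_one hm ha hx, fun hx => ?_⟩⟩
    exact hℓ.mem_affineTorus_of_prod ha fun m hm => hx m hm

/-! ### Two ends -/

theorem IsLine.eq_affineTorus_of_two (hℓ : IsLine ℓ) {e₁ e₂ : ends ℓ} (hne : e₁ ≠ e₂)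
    (hall : ∀ e, e = e₁ ∨ e = e₂) : ℓ = affineTorus ℓ := by
  refine hℓ.subset_affineTorus.antisymm fun x hx => ?_
  obtain ⟨ι, hι⟩ := hℓ.exists_isEndCoordinate
  have h := hℓ.spans_of_mem (fun h => hne (Subtype.ext h)) e₁.2.1 e₂.2.1
    (Projectivization.rep_nonzero _) (Projectivization.rep_nonzero _)
    (rep_mem_submodule (e₁ : PSpace n)) (rep_mem_submodule (e₂ : PSpace n))
  -- The coordinate chosen for one end vanishes on the representative of that end, so it reads off
  -- the coefficient of the other.
  refine (hℓ.mem_iff h).2 ⟨hom x (ι e₂) / (e₁ : PSpace n).rep (ι e₂),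
    hom x (ι e₁) / (e₂ : PSpace n).rep (ι e₁), hℓ.hom_eq_of_mem_affineTorus h hι hx fun e => ?_⟩
  rcases hall e with rfl | rfl
  · rw [hι e, mul_zero, zero_add, div_mul_cancel₀ _ (hℓ.rep_ne_zero hι hne.symm)]
  · rw [hι e, mul_zero, add_zero, div_mul_cancel₀ _ (hℓ.rep_ne_zero hι hne)]

theorem IsLine.isRationalAffineLine_of_two (hℓ : IsLine ℓ) {e : ends ℓ} (hne : e ≠ hℓ.endOf 0)
    (hall : ∀ f, f = hℓ.endOf 0 ∨ f = e) : IsRationalAffineLine (algAmoeba ℓ) := by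
  classical
  obtain ⟨a, ha⟩ := hℓ.nonempty
  obtain ⟨i₀, hi₀⟩ := hℓ.exists_endOf_succ hne
  -- Relative to a, the coordinates in the class of x₀ are fixed and those of the other end share
  -- one free factor; the direction is therefore the indicator of the latter class.
  refine ⟨fun i => Real.log ‖(a i : ℂ)‖, fun i => if hℓ.endOf i.succ = e then 1 else 0, ?_, ?_⟩
  · intro h
    simpa [hi₀] using congrFun h i₀
  have heq := hℓ.eq_affineTorus_of_two hne.symm hall
  ext y
  constructor
  · rintro ⟨_, ⟨x, hx, rfl⟩, rfl⟩
    replace hx := hℓ.subset_affineTorus hx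
    obtain ⟨b, hb0, hb⟩ := (hℓ.mem_affineTorus_iff_exists ha).1 hx
    refine ⟨Real.log ‖(b e : ℂ)‖, fun i => ?_⟩
    have hxi : (x i : ℂ) = a i * b (hℓ.endOf i.succ) := by
      rw [← hb, ← Units.val_mul, mul_div_cancel]
    have hlog : Real.log ‖(x i : ℂ)‖ =
        Real.log ‖(a i : ℂ)‖ + Real.log ‖(b (hℓ.endOf i.succ) : ℂ)‖ := by
      rw [hxi, norm_mul, Real.log_mul (by simp) (by simp)]
    simp only [absMap, hlog]
    rcases hall (hℓ.endOf i.succ) with h | h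
    · rw [if_neg (by rw [h]; exact hne.symm), h, hb0]; simp
    · rw [if_pos h, h]; simp
  · rintro ⟨s, hs⟩
    have hexp : ∀ r : ℝ, Complex.exp r ≠ 0 := fun r => Complex.exp_ne_zero _
    refine ⟨_, ⟨fun i => a i * (if hℓ.endOf i.succ = e then Units.mk0 _ (hexp s) else 1),
      heq.symm.subset <| (hℓ.mem_affineTorus_iff_exists ha).2
        ⟨fun f => if f = e then Units.mk0 _ (hexp s) else 1, by simp [hne.symm], fun i => mul_div_cancel_left _ _⟩,
      rfl⟩, ?_⟩
    funext i
    simp only [absMap, hs i]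
    split_ifs with h
    · simp [Real.log_mul, Complex.norm_exp]
    · simp

/-! ### Three ends -/

variable {e₁ e₂ e₃ : ends ℓ}

theorem Chart.exists_mem (c : Chart ℓ e₁ e₂ e₃) (hℓ : IsLine ℓ) {s t : ℂ}
    (hst : ∀ e, c.form e s t ≠ 0) : ∃ x ∈ ℓ, ∃ d : ℂ, d ≠ 0 ∧ hom x = d • (s • c.w₁ + t • c.w₂) := by
  have hne : ∀ i, (s • c.w₁ + t • c.w₂) i ≠ 0 := by
    intro i
    simp only [Pi.add_apply, Pi.smul_apply, smul_eq_mul]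
    obtain ⟨y, hy⟩ := hℓ.nonempty
    obtain ⟨s', t', hst'⟩ := (hℓ.mem_iff c.spans).1 hy
    have h1 : hom y i = s' * c.w₁ i + t' * c.w₂ i := by simp [hst']
    rw [c.coord_of_rep_eq_zero (hℓ.rep_endOf i)] at h1 ⊢
    exact mul_ne_zero (left_ne_zero_of_mul (h1 ▸ hom_apply_ne_zero y i)) (hst _)
  obtain ⟨x, hx⟩ := exists_torus_hom_eq hne
  exact ⟨x, (hℓ.mem_iff c.spans).2 ⟨_, _, by rw [hx, smul_add, smul_smul, smul_smul]⟩, _,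
    inv_ne_zero (hne 0), hx⟩

/-- With the end of x₀ at ∞, x₀ is constant on the vectors with t = 1. The normalization x₀ = 1 then
uses the same scalar for both points, and it cancels in the ratio. -/
theorem Chart.div_eq_form_div (c : Chart ℓ e₁ e₂ e₃) (hℓ : IsLine ℓ) (h₀ : hℓ.endOf 0 = e₁)
    {x y : Torus n} {d d' s s' : ℂ} (hx : hom x = d • (s • c.w₁ + (1 : ℂ) • c.w₂))
    (hy : hom y = d' • (s' • c.w₁ + (1 : ℂ) • c.w₂)) (i : Fin n) :
    (x i / y i : ℂ) = c.form (hℓ.endOf i.succ) s 1 / c.form (hℓ.endOf i.succ) s' 1 := by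
  classical
  have key : ∀ {x : Torus n} {d s : ℂ}, hom x = d • (s • c.w₁ + (1 : ℂ) • c.w₂) → ∀ i,
      hom x i = d * ((if hℓ.endOf i = e₁ then c.w₂ i else c.w₁ i) *
        c.form (hℓ.endOf i) s 1) := by
    intro x d s hx i
    rw [hx, ← c.coord_of_rep_eq_zero (hℓ.rep_endOf i)]
    simp
  have hd : ∀ {x : Torus n} {d s : ℂ}, hom x = d • (s • c.w₁ + (1 : ℂ) • c.w₂) →
      d * c.w₂ 0 = 1 := by
    intro x d s hx
    have := key hx 0
    rw [if_pos h₀, h₀, c.form_one, hom_zero, mul_one] at this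
    exact this.symm
  have h1 := hd hx
  have h2 := hd hy
  have hw : c.w₂ 0 ≠ 0 := right_ne_zero_of_mul (h1 ▸ one_ne_zero)
  have hdd : d = d' := mul_right_cancel₀ hw (h1.trans h2.symm)
  have hyi := hom_apply_ne_zero y i.succ
  rw [key hy] at hyi
  rw [← hom_succ x, ← hom_succ y, key hx, key hy, hdd, ← mul_assoc, ← mul_assoc,
    mul_div_mul_left]
  rw [← mul_assoc] at hyi
  exact left_ne_zero_of_mul hyi

/-- In the chart the character is a constant times s^k₂ (s - 1)^k₃ for s ≠ 0, 1, which is constant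
only if both exponents vanish. -/
theorem IsLine.classSum_eq_zero_of_three (hℓ : IsLine ℓ) (c : Chart ℓ e₁ e₂ e₃)
    (h₀ : hℓ.endOf 0 = e₁) (hall : ∀ e, e = e₁ ∨ e = e₂ ∨ e = e₃) {m : Fin n → ℤ} {a : Torus n}
    (hm : ∀ x ∈ ℓ, ∏ i, (x i / a i) ^ m i = 1) : hℓ.classSum m = 0 := by
  classical
  have hform : ∀ s : ℂ, s ≠ 0 → s ≠ 1 → ∀ e, c.form e s 1 ≠ 0 := by
    intro s h0 h1 e
    rcases hall e with rfl | rfl | rfl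
    · rw [c.form_one]; exact one_ne_zero
    · rw [c.form_two]; exact h0
    · rw [c.form_three]; exact sub_ne_zero.2 h1
  let k : ends ℓ → ℤ := fun e => ∑ i with hℓ.endOf (Fin.succ i) = e, m i
  have := hℓ.finite_ends
  have := Fintype.ofFinite (ends ℓ)
  have huniv : (Finset.univ : Finset (ends ℓ)) = {e₁, e₂, e₃} := by
    ext e; simpa using hall e
  have key : ∀ s s' : ℂ, s ≠ 0 → s ≠ 1 → s' ≠ 0 → s' ≠ 1 →
      ‖s / s'‖ ^ k e₂ * ‖(s - 1) / (s' - 1)‖ ^ k e₃ = 1 := by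
    intro s s' hs0 hs1 hs0' hs1'
    obtain ⟨x, hx, d, -, hxd⟩ := c.exists_mem hℓ (hform s hs0 hs1)
    obtain ⟨y, hy, d', -, hyd⟩ := c.exists_mem hℓ (hform s' hs0' hs1')
    have h1 : ∏ i, (x i / y i) ^ m i = 1 := by
      have : ∏ i, (x i / y i) ^ m i = (∏ i, (x i / a i) ^ m i) / ∏ i, (y i / a i) ^ m i := by
        rw [← Finset.prod_div_distrib]
        refine Finset.prod_congr rfl fun i _ => ?_
        rw [← div_zpow, div_div_div_cancel_right]
      rw [this, hm x hx, hm y hy, div_one]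
    have h2 : ∀ i, x i / y i = Units.mk0 (c.form (hℓ.endOf i.succ) s 1 /
        c.form (hℓ.endOf i.succ) s' 1)
          (div_ne_zero (hform s hs0 hs1 _) (hform s' hs0' hs1' _)) := by
      intro i
      ext
      rw [Units.val_mk0, ← c.div_eq_form_div hℓ h₀ hxd hyd i]
      simp
    simp only [h2] at h1
    rw [prod_zpow_fiberwise (fun i : Fin n => hℓ.endOf i.succ) m (fun e => Units.mk0
      (c.form e s 1 / c.form e s' 1) (div_ne_zero (hform s hs0 hs1 _) (hform s' hs0' hs1' _))),
      huniv, Finset.prod_insert (by simp [c.ne₁₂, c.ne₁₃]), Finset.prod_pair c.ne₂₃] at h1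
    have h3 := congrArg (fun u : ℂˣ => ‖(u : ℂ)‖) h1
    simpa [c.form_one, c.form_two, c.form_three, k] using h3
  -- These two pairs give powers of 2 only: 2^(k₂ - k₃) = 1 and 2^(2k₂ + k₃) = 1, hence k₂ = k₃ = 0.
  have k1 := key 2 (-1) (by norm_num) (by norm_num) (by norm_num) (by norm_num)
  have k2 := key 2 (1 / 2) (by norm_num) (by norm_num) (by norm_num) (by norm_num)
  have e1 : k e₂ - k e₃ = 0 := by
    rw [← zpow_eq_one_iff_right₀ (a := (2 : ℝ)) (by norm_num) (by norm_num), zpow_sub₀ (by norm_num),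
      div_eq_mul_inv, ← inv_zpow]
    norm_num at k1 ⊢
    exact k1
  have e2 : 2 * k e₂ + k e₃ = 0 := by
    rw [← zpow_eq_one_iff_right₀ (a := (2 : ℝ)) (by norm_num) (by norm_num), zpow_add₀ (by norm_num),
      zpow_mul]
    norm_num at k2 ⊢
    exact k2
  funext e
  rw [hℓ.classSum_apply]
  rcases hall e.1 with h | h | h
  · exact absurd (h.trans h₀.symm) e.2
  · rw [h]; change k e₂ = 0; omega
  · rw [h]; change k e₃ = 0; omega

/-- Every character that is constant on ℓ is already constant on a𝕋_ℓ, so the equations of T impose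
nothing new there. -/
theorem IsLine.minimal_of_three (hℓ : IsLine ℓ) (c : Chart ℓ e₁ e₂ e₃)
    (h₀ : hℓ.endOf 0 = e₁) (hall : ∀ e, e = e₁ ∨ e = e₂ ∨ e = e₃) {T : Set (Torus n)} {d : ℕ}
    (hT : IsAffineSubtorus T d) (hℓT : ℓ ⊆ T) (hTa : T ⊆ affineTorus ℓ) : T = affineTorus ℓ := by
  refine hTa.antisymm fun x hx => ?_
  obtain ⟨M, -, -, a, rfl⟩ := hT
  obtain ⟨b, hb⟩ := hℓ.nonempty
  intro m hm
  have h1 := hℓ.prod_zpow_eq_one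
    (hℓ.classSum_eq_zero_of_three c h₀ hall (fun y hy => hℓT hy m hm)) hb hx
  have h2 := hℓT hb m hm
  have : ∏ i, (x i / a i) ^ m i = (∏ i, (x i / b i) ^ m i) * ∏ i, (b i / a i) ^ m i := by
    rw [← Finset.prod_mul_distrib]
    refine Finset.prod_congr rfl fun i _ => ?_
    rw [← mul_zpow, div_mul_div_cancel]
  rw [this, h1, h2, one_mul]

theorem triangleIneq_of_add_eq_zero {X Y Z : ℂ} (h : X + Y + Z = 0) : TriangleIneq ‖X‖ ‖Y‖ ‖Z‖ := by
  have hZ : ‖Z‖ = ‖X + Y‖ := by rw [eq_neg_of_add_eq_zero_right h, norm_neg]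
  refine ⟨hZ ▸ norm_add_le _ _, ?_⟩
  have := abs_norm_sub_norm_le X (-Y)
  rwa [norm_neg, sub_neg_eq_add, ← hZ] at this

/-- A triangle with sides p, q, r: t lies on the positive real axis, and the law of cosines gives
the real part x of s. -/
theorem exists_norm_eq_of_triangleIneq {p q r : ℝ} (hp : 0 < p) (hq : 0 < q) (hr : 0 < r)
    (h : TriangleIneq p q r) : ∃ s t : ℂ, ‖t‖ = p ∧ ‖s‖ = q ∧ ‖s - t‖ = r := by
  obtain ⟨h1, h2⟩ := h
  rw [abs_le] at h2
  set x := (p ^ 2 + q ^ 2 - r ^ 2) / (2 * p) with hx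
  have hx' : 2 * p * x = p ^ 2 + q ^ 2 - r ^ 2 := by rw [hx]; field_simp
  have hy : 0 ≤ q ^ 2 - x ^ 2 := by
    have : 0 ≤ (2 * p) ^ 2 * (q ^ 2 - x ^ 2) := by
      -- Heron's formula: both sides are 16 times the squared area, and the triangle inequalities
      -- make each factor nonnegative.
      have : (2 * p) ^ 2 * (q ^ 2 - x ^ 2) =
          ((p + q + r) * (p + q - r)) * ((r + (p - q)) * (r - (p - q))) := by
        linear_combination -(2 * p * x + (p ^ 2 + q ^ 2 - r ^ 2)) * hx'
      rw [this]
      exact mul_nonneg (mul_nonneg (by linarith) (by linarith))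
        (mul_nonneg (by linarith) (by linarith))
    exact nonneg_of_mul_nonneg_right this (by positivity)
  have hsq := Real.sq_sqrt hy
  refine ⟨⟨x, √(q ^ 2 - x ^ 2)⟩, (p : ℂ), by simp [hp.le], ?_, ?_⟩
  · rw [← sq_eq_sq₀ (norm_nonneg _) hq.le, Complex.sq_norm, Complex.normSq_mk]
    linarith
  · rw [← sq_eq_sq₀ (norm_nonneg _) hr.le, Complex.sq_norm, Complex.normSq_apply]
    simp only [Complex.sub_re, Complex.sub_im, Complex.ofReal_re, Complex.ofReal_im]
    linarith

/-- The relation between the coordinates of the three ends of a chart. -/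
theorem Chart.planar_relation (c : Chart ℓ e₁ e₂ e₃) (hℓ : IsLine ℓ) (hι : IsEndCoordinate ℓ ι)
    {x : Torus n} (hx : x ∈ ℓ) : (c.κ ι e₁)⁻¹ * hom x (ι e₁) + -(c.κ ι e₂)⁻¹ * hom x (ι e₂) +
      (c.κ ι e₃)⁻¹ * hom x (ι e₃) = 0 := by
  obtain ⟨s, t, hst⟩ := (hℓ.mem_iff c.spans).1 hx
  rw [c.hom_apply hι hst, c.hom_apply hι hst, c.hom_apply hι hst, neg_mul,
    inv_mul_cancel_left₀ (c.κ_ne_zero hℓ hι _), inv_mul_cancel_left₀ (c.κ_ne_zero hℓ hι _),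
    inv_mul_cancel_left₀ (c.κ_ne_zero hℓ hι _), c.form_one, c.form_two, c.form_three]
  ring

theorem Chart.exists_norm_eq (c : Chart ℓ e₁ e₂ e₃) (hℓ : IsLine ℓ) (hι : IsEndCoordinate ℓ ι)
    {R : ends ℓ → ℝ} (hR : ∀ e, 0 < R e)
    (h : TriangleIneq (‖(c.κ ι e₁)⁻¹‖ * R e₁) (‖-(c.κ ι e₂)⁻¹‖ * R e₂) (‖(c.κ ι e₃)⁻¹‖ * R e₃)) :
    ∃ s t : ℂ, R e₁ = ‖c.κ ι e₁ * c.form e₁ s t‖ ∧ R e₂ = ‖c.κ ι e₂ * c.form e₂ s t‖ ∧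
      R e₃ = ‖c.κ ι e₃ * c.form e₃ s t‖ := by
  have hκ := c.norm_coord_pos hℓ hι
  simp only [norm_neg, norm_inv] at h
  obtain ⟨s, t, h1, h2, h3⟩ := exists_norm_eq_of_triangleIneq
    (mul_pos (inv_pos.2 (hκ e₁)) (hR _)) (mul_pos (inv_pos.2 (hκ e₂)) (hR _))
    (mul_pos (inv_pos.2 (hκ e₃)) (hR _)) h
  refine ⟨s, t, ?_, ?_, ?_⟩
  · rw [norm_mul, c.form_one, h1, mul_inv_cancel_left₀ (hκ _).ne']
  · rw [norm_mul, c.form_two, h2, mul_inv_cancel_left₀ (hκ _).ne']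
  · rw [norm_mul, c.form_three, h3, mul_inv_cancel_left₀ (hκ _).ne']

theorem IsLine.three_ends (hℓ : IsLine ℓ) (c : Chart ℓ e₁ e₂ e₃) (hι : IsEndCoordinate ℓ ι)
    (hall : ∀ e, e = e₁ ∨ e = e₂ ∨ e = e₃) :
    ∃ a b d : ℂ, a ≠ 0 ∧ b ≠ 0 ∧ d ≠ 0 ∧
      ℓ = {x ∈ affineTorus ℓ | a * hom x (ι e₁) + b * hom x (ι e₂) + d * hom x (ι e₃) = 0} ∧
      algAmoeba ℓ = {r ∈ algAmoeba (affineTorus ℓ) | TriangleIneq (‖a‖ * homReal r (ι e₁))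
        (‖b‖ * homReal r (ι e₂)) (‖d‖ * homReal r (ι e₃))} := by
  have hκ := c.κ_ne_zero hℓ hι
  -- The coefficients come from t - s + (s - t) = 0 after dividing each coordinate by its constant
  -- κ.
  refine ⟨(c.κ ι e₁)⁻¹, -(c.κ ι e₂)⁻¹, (c.κ ι e₃)⁻¹, inv_ne_zero (hκ _),
    neg_ne_zero.2 (inv_ne_zero (hκ _)), inv_ne_zero (hκ _), ?_, ?_⟩
  · refine Set.Subset.antisymm
      (fun x hx => ⟨hℓ.subset_affineTorus hx, c.planar_relation hℓ hι hx⟩) ?_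
    rintro x ⟨hx, h⟩
    refine (hℓ.mem_iff c.spans).2 ⟨(c.κ ι e₂)⁻¹ * hom x (ι e₂), (c.κ ι e₁)⁻¹ * hom x (ι e₁),
      hℓ.hom_eq_of_mem_affineTorus c.spans hι hx fun e => ?_⟩
    rw [c.coord hι]
    rcases hall e with rfl | rfl | rfl
    · rw [c.form_one, mul_inv_cancel_left₀ (hκ _)]
    · rw [c.form_two, mul_inv_cancel_left₀ (hκ _)]
    · rw [c.form_three, ← mul_right_inj' (inv_ne_zero (hκ e)), inv_mul_cancel_left₀ (hκ _)]
      linear_combination h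
  · refine Set.Subset.antisymm ?_ ?_
    · rintro _ ⟨x, hx, rfl⟩
      refine ⟨⟨x, hℓ.subset_affineTorus hx, rfl⟩, ?_⟩
      simp only [homReal_absMap, ← norm_mul]
      exact triangleIneq_of_add_eq_zero (c.planar_relation hℓ hι hx)
    · rintro r ⟨hr, h⟩
      obtain ⟨s, t, h1, h2, h3⟩ := c.exists_norm_eq hℓ hι (R := fun e => homReal r (ι e))
        (fun e => homReal_pos_of_mem hr _) h
      refine (hℓ.mem_algAmoeba_iff c.spans hι hr).2 ⟨s, t, fun e => ?_⟩
      rw [c.coord hι]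
      rcases hall e with rfl | rfl | rfl <;> assumption

end Tori

/-! ### Fibres of the map to the amoeba. -/

section Fibres

variable {n : ℕ} {ℓ : Set (Torus n)} {ι : ends ℓ → Fin (n + 1)} {e₁ e₂ e₃ : ends ℓ}

theorem eq_of_hom_eq_smul {x y : Torus n} {v : Fin (n + 1) → ℂ} {c d : ℂ} (hx : hom x = c • v)
    (hy : hom y = d • v) : x = y := by
  have h1 : 1 = c * v 0 := by simpa using congrFun hx 0
  have h2 : 1 = d * v 0 := by simpa using congrFun hy 0
  have hcd : c = d := mul_right_cancel₀ (right_ne_zero_of_mul (h1 ▸ one_ne_zero)) (h1.symm.trans h2)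
  exact hom_injective (by rw [hx, hy, hcd])

/-- The difference of the squared distances to 0 and 1 gives the real part; the modulus then gives
the square of the imaginary part. -/
theorem eq_or_eq_conj_of_norm_eq {ξ η : ℂ} (h₀ : ‖ξ‖ = ‖η‖) (h₁ : ‖ξ - 1‖ = ‖η - 1‖) :
    η = ξ ∨ η = starRingEnd ℂ ξ := by
  rw [← sq_eq_sq₀ (norm_nonneg _) (norm_nonneg _), Complex.sq_norm, Complex.sq_norm,
    Complex.normSq_apply, Complex.normSq_apply] at h₀ h₁
  simp only [Complex.sub_re, Complex.sub_im, Complex.one_re, Complex.one_im] at h₁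
  have hre : η.re = ξ.re := by linarith
  have him : (η.im - ξ.im) * (η.im + ξ.im) = 0 := by rw [hre] at h₀; linarith
  rcases mul_eq_zero.1 him with h | h
  · left; exact Complex.ext hre (by linarith)
  · right; exact Complex.ext (by simpa using hre) (by rw [Complex.conj_im]; linarith)

/-- The two squared distances differ by 4 Im ξ Im z up to sign. -/
theorem norm_sub_eq_norm_conj_sub_iff {ξ z : ℂ} :
    ‖ξ - z‖ = ‖starRingEnd ℂ ξ - z‖ ↔ ξ.im = 0 ∨ z.im = 0 := by
  rw [← sq_eq_sq₀ (norm_nonneg _) (norm_nonneg _), Complex.sq_norm, Complex.sq_norm,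
    Complex.normSq_apply, Complex.normSq_apply, ← mul_eq_zero]
  simp only [Complex.sub_re, Complex.sub_im, Complex.conj_re, Complex.conj_im]
  constructor <;> intro h <;> linarith

namespace Chart

variable (c : Chart ℓ e₁ e₂ e₃)

theorem exists_hom_eq (hℓ : IsLine ℓ) (hι : IsEndCoordinate ℓ ι) {x : Torus n} (hx : x ∈ ℓ) :
    ∃ ξ d : ℂ, d ≠ 0 ∧ hom x = d • (ξ • c.w₁ + c.w₂) := by
  obtain ⟨s, t, hst⟩ := (hℓ.mem_iff c.spans).1 hx
  have ht : t ≠ 0 := by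
    rintro rfl
    apply hom_apply_ne_zero x (ι e₁)
    rw [c.hom_apply hι hst, c.form_one, mul_zero]
  exact ⟨s / t, t, ht, by rw [hst, smul_add, smul_smul, mul_div_cancel₀ _ ht]⟩

theorem norm_hom_apply (hι : IsEndCoordinate ℓ ι) {x : Torus n} {ξ d : ℂ}
    (hx : hom x = d • (ξ • c.w₁ + c.w₂)) (e : ends ℓ) :
    ‖hom x (ι e)‖ = ‖c.κ ι e‖ * (‖d‖ * ‖c.form e ξ 1‖) := by
  rw [smul_add, smul_smul] at hx
  rw [c.hom_apply hι hx, norm_mul]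
  congr 1
  rw [← norm_mul]
  congr 1
  by_cases he : e = e₁
  · rw [he, c.form_one, c.form_one, mul_one]
  · rw [c.form_of_ne he, c.form_of_ne he]; ring

theorem norm_sub_eq_of_absMap_eq (hℓ : IsLine ℓ) (hι : IsEndCoordinate ℓ ι) {x y : Torus n}
    {ξ η d d' : ℂ} (hd : d ≠ 0) (hx : hom x = d • (ξ • c.w₁ + c.w₂))
    (hy : hom y = d' • (η • c.w₁ + c.w₂)) (h : absMap x = absMap y) {e : ends ℓ} (he : e ≠ e₁) :
    ‖ξ - c.z e‖ = ‖η - c.z e‖ := by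
  have key : ∀ e, ‖d‖ * ‖c.form e ξ 1‖ = ‖d'‖ * ‖c.form e η 1‖ := by
    intro e
    apply mul_left_cancel₀ (c.norm_coord_pos hℓ hι e).ne'
    rw [← c.norm_hom_apply hι hx, ← c.norm_hom_apply hι hy, ← homReal_absMap, ← homReal_absMap, h]
  have h1 : ‖d‖ = ‖d'‖ := by simpa [c.form_one] using key e₁
  have h2 := key e
  rw [← h1] at h2
  simpa [c.form_of_ne he] using mul_left_cancel₀ (norm_ne_zero_iff.2 hd) h2

theorem eq_or_eq_conj (hℓ : IsLine ℓ) (hι : IsEndCoordinate ℓ ι) {x y : Torus n}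
    {ξ η d d' : ℂ} (hd : d ≠ 0) (hx : hom x = d • (ξ • c.w₁ + c.w₂))
    (hy : hom y = d' • (η • c.w₁ + c.w₂)) (h : absMap x = absMap y) :
    η = ξ ∨ η = starRingEnd ℂ ξ := by
  have h0 := c.norm_sub_eq_of_absMap_eq hℓ hι hd hx hy h c.ne₁₂.symm
  have h1 := c.norm_sub_eq_of_absMap_eq hℓ hι hd hx hy h c.ne₁₃.symm
  rw [c.z₂, sub_zero, sub_zero] at h0
  rw [c.z₃] at h1
  exact eq_or_eq_conj_of_norm_eq h0 h1

theorem toP_mem_circle_iff {x : Torus n} {ξ d : ℂ} (hd : d ≠ 0)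
    (hx : hom x = d • (ξ • c.w₁ + c.w₂)) : toP x ∈ c.circle ↔ ξ.im = 0 := by
  rw [c.mem_circle_iff_of_mem (s := ξ) (t := 1) one_ne_zero, div_one]
  rw [one_smul, ← Submodule.smul_mem_iff _ hd, ← hx]
  exact hom_mem_toP x

theorem isRealLine_iff : IsRealLine ℓ ↔ ends ℓ ⊆ c.circle := by
  constructor
  · rintro ⟨C, hC, hE⟩
    rwa [c.eq_circle hC (hE e₁.2) (hE e₂.2) (hE e₃.2)] at hE
  · intro h
    exact ⟨_, c.isCircle_circle, h⟩

theorem exists_im_ne_zero (h : IsComplexLine ℓ) : ∃ e, e ≠ e₁ ∧ (c.z e).im ≠ 0 := by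
  rw [IsComplexLine, c.isRealLine_iff, Set.not_subset] at h
  obtain ⟨e, he, hec⟩ := h
  have hne : (⟨e, he⟩ : ends ℓ) ≠ e₁ := by rintro rfl; exact hec c.mem_circle_one
  exact ⟨⟨e, he⟩, hne, fun h0 => hec ((c.mem_circle_iff hne).2 h0)⟩

/-- Distances to 0 and 1 leave only conjugation open, and an end at a nonreal position excludes it
unless the point is fixed by it. -/
theorem injOn_of_isComplexLine (c : Chart ℓ e₁ e₂ e₃) (hℓ : IsLine ℓ) (h : IsComplexLine ℓ) :
    Set.InjOn absMap ℓ := by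
  intro x hx y hy hxy
  obtain ⟨ι, hι⟩ := hℓ.exists_isEndCoordinate
  obtain ⟨ξ, d, hd, hxd⟩ := c.exists_hom_eq hℓ hι hx
  obtain ⟨η, d', hd', hyd⟩ := c.exists_hom_eq hℓ hι hy
  obtain ⟨e, he, hze⟩ := c.exists_im_ne_zero h
  have hη : η = ξ := by
    rcases c.eq_or_eq_conj hℓ hι hd hxd hyd hxy with h | rfl
    · exact h
    have := norm_sub_eq_norm_conj_sub_iff.1 (c.norm_sub_eq_of_absMap_eq hℓ hι hd hxd hyd hxy he)
    exact Complex.conj_eq_iff_im.2 (this.resolve_right hze)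
  subst hη
  exact eq_of_hom_eq_smul hxd hyd

theorem injOn_circle (hℓ : IsLine ℓ) : Set.InjOn absMap {x ∈ ℓ | toP x ∈ c.circle} := by
  rintro x ⟨hx, hxc⟩ y ⟨hy, hyc⟩ hxy
  obtain ⟨ι, hι⟩ := hℓ.exists_isEndCoordinate
  obtain ⟨ξ, d, hd, hxd⟩ := c.exists_hom_eq hℓ hι hx
  obtain ⟨η, d', hd', hyd⟩ := c.exists_hom_eq hℓ hι hy
  rw [c.toP_mem_circle_iff hd hxd] at hxc
  have hη : η = ξ := by
    rcases c.eq_or_eq_conj hℓ hι hd hxd hyd hxy with h | rfl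
    · exact h
    · exact Complex.conj_eq_iff_im.2 hxc
  subst hη
  exact eq_of_hom_eq_smul hxd hyd

theorem fibre_of_real (hℓ : IsLine ℓ) (hE : ends ℓ ⊆ c.circle) {x : Torus n} (hx : x ∈ ℓ)
    (hxc : toP x ∉ c.circle) : {y ∈ ℓ | absMap y = absMap x}.ncard = 2 ∧
      ∀ y ∈ ℓ, absMap y = absMap x → toP y ∉ c.circle := by
  obtain ⟨ι, hι⟩ := hℓ.exists_isEndCoordinate
  obtain ⟨ξ, d, hd, hxd⟩ := c.exists_hom_eq hℓ hι hx
  rw [c.toP_mem_circle_iff hd hxd] at hxc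
  constructor
  · have hr : absMap x ∈ algAmoeba (affineTorus ℓ) := ⟨x, hℓ.subset_affineTorus hx, rfl⟩
    -- All ends other than e₁ have real positions, so the point with parameter ξ̄ has the same
    -- absolute values; this is the second point of the fibre.
    obtain ⟨y, hy, hyx, b, hb, hyb⟩ := hℓ.exists_mem_of_norm c.spans hι hr
      (s := d * starRingEnd ℂ ξ) (t := d) (fun e => by
        rw [homReal_absMap, c.norm_hom_apply hι hxd, c.coord hι, norm_mul, ← norm_mul]
        congr 1
        by_cases he : e = e₁
        · rw [he, c.form_one, c.form_one, mul_one]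
        · have := (norm_sub_eq_norm_conj_sub_iff (ξ := ξ)).2
            (Or.inr ((c.mem_circle_iff he).1 (hE e.2)))
          rw [c.form_of_ne he, c.form_of_ne he, norm_mul, mul_one, this, ← norm_mul]
          congr 1; ring)
    have hyb' : hom y = (b * d) • (starRingEnd ℂ ξ • c.w₁ + c.w₂) := by
      rw [hyb]; module
    have hne : x ≠ y := by
      rintro rfl
      apply hxc
      have h0 : (d * ξ - b * d * starRingEnd ℂ ξ) • c.w₁ + (d - b * d) • c.w₂ = 0 := by
        rw [← sub_eq_zero.2 (hxd.symm.trans hyb')]; module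
      obtain ⟨h1, h2⟩ := LinearIndependent.pair_iff.1 c.spans.li _ _ h0
      rw [sub_eq_zero] at h1 h2
      rw [← h2] at h1
      exact Complex.conj_eq_iff_im.1 (mul_left_cancel₀ hd h1).symm
    rw [← Set.ncard_pair hne]
    congr 1
    ext u
    constructor
    · rintro ⟨hu, hux⟩
      obtain ⟨η, d', hd', hud⟩ := c.exists_hom_eq hℓ hι hu
      rcases c.eq_or_eq_conj hℓ hι hd hxd hud hux.symm with rfl | rfl
      · left; exact eq_of_hom_eq_smul hud hxd
      · right; exact eq_of_hom_eq_smul hud hyb'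
    · rintro (rfl | rfl)
      · exact ⟨hx, rfl⟩
      · exact ⟨hy, hyx⟩
  · intro y hy hyx
    obtain ⟨η, d', hd', hyd⟩ := c.exists_hom_eq hℓ hι hy
    rw [c.toP_mem_circle_iff hd' hyd]
    rcases c.eq_or_eq_conj hℓ hι hd hxd hyd hyx.symm with rfl | rfl
    · exact hxc
    · simpa using hxc

end Chart

/-! ### The plane over the line and the squares of the coordinates -/

/-- The vectors over the closure of the line. -/
def cone (ℓ : Set (Torus n)) : Set (Fin (n + 1) → ℂ) := {w | ∃ p ∈ projClosure ℓ, w ∈ p.submodule}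

theorem Spans.mem_cone_iff {w₁ w₂ w : Fin (n + 1) → ℂ} (h : Spans ℓ w₁ w₂) :
    w ∈ cone ℓ ↔ ∃ s t : ℂ, w = s • w₁ + t • w₂ := by
  by_cases hw : w = 0
  · subst hw
    have h1 : w₁ ≠ 0 := by simpa using h.li.ne_zero 0
    exact ⟨fun _ => ⟨0, 0, by simp⟩, fun _ => ⟨Projectivization.mk ℂ w₁ h1,
      (h.mem_closure_iff h1 (mem_submodule_mk h1)).2 ⟨1, 0, by simp⟩, Submodule.zero_mem _⟩⟩
  · constructor
    · rintro ⟨p, hp, hwp⟩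
      exact (h.mem_closure_iff hw hwp).1 hp
    · intro hst
      exact ⟨_, (h.mem_closure_iff hw (mem_submodule_mk hw)).2 hst, mem_submodule_mk hw⟩

theorem hom_mem_cone {x : Torus n} (hx : x ∈ ℓ) : hom x ∈ cone ℓ :=
  ⟨_, toP_mem_projClosure hx, hom_mem_toP x⟩

theorem IsLine.mem_algAmoeba_iff_cone (hℓ : IsLine ℓ) (hι : IsEndCoordinate ℓ ι) {r : Fin n → ℝ}
    (hr : r ∈ algAmoeba (affineTorus ℓ)) :
    r ∈ algAmoeba ℓ ↔ ∃ w ∈ cone ℓ, ∀ e, homReal r (ι e) = ‖w (ι e)‖ := by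
  obtain ⟨w₁, w₂, h⟩ := hℓ.exists_spans
  rw [hℓ.mem_algAmoeba_iff h hι hr]
  constructor
  · rintro ⟨s, t, hst⟩
    exact ⟨_, h.mem_cone_iff.2 ⟨s, t, rfl⟩, hst⟩
  · rintro ⟨w, hw, hwr⟩
    obtain ⟨s, t, rfl⟩ := h.mem_cone_iff.1 hw
    exact ⟨s, t, hwr⟩

theorem Chart.norm_apply (c : Chart ℓ e₁ e₂ e₃) (hι : IsEndCoordinate ℓ ι) (e : ends ℓ) (s t : ℂ) :
    ‖(s • c.w₁ + t • c.w₂) (ι e)‖ = ‖c.κ ι e‖ * ‖c.form e s t‖ := by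
  rw [← norm_mul, ← c.coord hι]; simp

theorem IsLine.exists_three_ends (hℓ : IsLine ℓ) (h : 3 ≤ (ends ℓ).ncard) :
    ∃ e₁ e₂ e₃ : ends ℓ, Nonempty (Chart ℓ e₁ e₂ e₃) := by
  have := hℓ.finite_ends
  have := Fintype.ofFinite (ends ℓ)
  rw [← Nat.card_coe_set_eq, Nat.card_eq_fintype_card] at h
  obtain ⟨a, b, c, h1, h2, h3⟩ := Fintype.two_lt_card_iff.1 h
  exact ⟨a, b, c, hℓ.nonempty_chart h1 h2 h3⟩

end Fibres

section Forms

open MvPolynomial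

/-! ### Polynomials -/

/-- A polynomial without X_i cannot see the change of the i-th entry from 0 to 1. -/
theorem mem_vars_of_eval_single_ne {σ : Type*} [DecidableEq σ] {Q : MvPolynomial σ ℝ} {i : σ}
    (h : eval (Pi.single i 1) Q ≠ eval 0 Q) : i ∈ Q.vars := by
  by_contra hi
  refine h (eval₂Hom_congr' rfl (fun j hj _ => ?_) rfl)
  have : j ≠ i := by rintro rfl; exact hi hj
  simp [this]

/-- A multiple of the square of a variable. -/
noncomputable def sqTerm {σ : Type*} (k : ℝ) (i : σ) : MvPolynomial σ ℝ := C k * X i ^ 2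

variable {σ : Type*}

@[simp] theorem eval_sqTerm (k : ℝ) (i : σ) (x : σ → ℝ) : eval x (sqTerm k i) = k * x i ^ 2 := by
  simp [sqTerm]

theorem isHomogeneous_sqTerm (k : ℝ) (i : σ) : (sqTerm k i).IsHomogeneous 2 := by
  simpa [sqTerm] using (isHomogeneous_C σ k).mul ((isHomogeneous_X ℝ i).pow 2)

theorem sqTerm_mem_supported (k : ℝ) {i : σ} {s : Set σ} (hi : i ∈ s) :
    sqTerm k i ∈ supported ℝ s :=
  Subalgebra.mul_mem _ (Subalgebra.algebraMap_mem _ k)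
    (Subalgebra.pow_mem _ ((X_mem_supported (R := ℝ)).2 hi) 2)

theorem vars_eq_image_of_supported {κ : Type*} [DecidableEq σ] {Q : MvPolynomial σ ℝ} {F : Finset κ}
    {ι : κ → σ} (hQ : Q ∈ supported ℝ (F.image ι : Set σ))
    (h : ∀ e ∈ F, eval (Pi.single (ι e) 1) Q ≠ eval 0 Q) : Q.vars = F.image ι := by
  apply Finset.Subset.antisymm
  · exact_mod_cast mem_supported.1 hQ
  · intro i hi
    obtain ⟨e, he, rfl⟩ := Finset.mem_image.1 hi
    exact mem_vars_of_eval_single_ne (h e he)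

/-- The diagonal quadratic form with coefficients `k`. -/
noncomputable def diagForm {κ : Type*} (F : Finset κ) (ι : κ → σ) (k : κ → ℝ) : MvPolynomial σ ℝ :=
  ∑ e ∈ F, sqTerm (k e) (ι e)

@[simp] theorem eval_diagForm {κ : Type*} (F : Finset κ) (ι : κ → σ) (k : κ → ℝ) (x : σ → ℝ) :
    eval x (diagForm F ι k) = ∑ e ∈ F, k e * x (ι e) ^ 2 := by
  simp [diagForm]

theorem isHomogeneous_diagForm {κ : Type*} (F : Finset κ) (ι : κ → σ) (k : κ → ℝ) :
    (diagForm F ι k).IsHomogeneous 2 :=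
  IsHomogeneous.sum _ _ _ fun _ _ => isHomogeneous_sqTerm _ _

theorem diagForm_mem_supported {κ : Type*} [DecidableEq σ] (F : Finset κ) (ι : κ → σ) (k : κ → ℝ) :
    diagForm F ι k ∈ supported ℝ (F.image ι : Set σ) :=
  Subalgebra.sum_mem _ fun _ he => sqTerm_mem_supported _
    (Finset.mem_coe.2 (Finset.mem_image_of_mem _ he))

theorem vars_diagForm {κ : Type*} [DecidableEq σ] {F : Finset κ} {ι : κ → σ}
    (hι : Function.Injective ι) {k : κ → ℝ} (hk : ∀ e ∈ F, k e ≠ 0) :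
    (diagForm F ι k).vars = F.image ι := by
  classical
  refine vars_eq_image_of_supported (diagForm_mem_supported _ _ _) fun e he => ?_
  rw [eval_diagForm, eval_diagForm, Finset.sum_eq_single e]
  · simpa using hk e he
  · intro f _ hf
    rw [Pi.single_eq_of_ne (hι.ne hf)]; simp
  · exact fun h => absurd he h

/-- The quartic form that vanishes on the squared distances `N`, `M`, `L` of a point of the plane
to `0`, `1`, `ω`, homogenized by `D`. -/
noncomputable def quarticForm (ω : ℂ) (D N M L : MvPolynomial σ ℝ) : MvPolynomial σ ℝ :=
  C (ω.im ^ 2) * (4 * (N * D) - (N + D - M) ^ 2) -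
    (N + C (Complex.normSq ω) * D - C ω.re * (N + D - M) - L) ^ 2

theorem eval_quarticForm (ω : ℂ) (D N M L : MvPolynomial σ ℝ) (x : σ → ℝ) :
    eval x (quarticForm ω D N M L) =
      ω.im ^ 2 * (4 * (eval x N * eval x D) - (eval x N + eval x D - eval x M) ^ 2) -
        (eval x N + Complex.normSq ω * eval x D - ω.re * (eval x N + eval x D - eval x M) -
          eval x L) ^ 2 := by
  simp [quarticForm]

theorem isHomogeneous_quarticForm (ω : ℂ) {D N M L : MvPolynomial σ ℝ} (hD : D.IsHomogeneous 2)
    (hN : N.IsHomogeneous 2) (hM : M.IsHomogeneous 2) (hL : L.IsHomogeneous 2) :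
    (quarticForm ω D N M L).IsHomogeneous 4 := by
  have hC : ∀ (a : ℝ) {p : MvPolynomial σ ℝ} {d : ℕ}, p.IsHomogeneous d →
      (C a * p).IsHomogeneous d := fun a p d hp => by simpa using (isHomogeneous_C σ a).mul hp
  have h4 : (4 : MvPolynomial σ ℝ) = C 4 := (map_ofNat C 4).symm
  refine IsHomogeneous.sub (hC _ (IsHomogeneous.sub ?_ (((hN.add hD).sub hM).pow 2)))
    ((((hN.add (hC _ hD)).sub (hC _ ((hN.add hD).sub hM))).sub hL).pow 2)
  rw [h4]
  exact hC _ (hN.mul hD)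

theorem quarticForm_mem_supported (ω : ℂ) {D N M L : MvPolynomial σ ℝ} {s : Set σ}
    (hD : D ∈ supported ℝ s) (hN : N ∈ supported ℝ s) (hM : M ∈ supported ℝ s)
    (hL : L ∈ supported ℝ s) : quarticForm ω D N M L ∈ supported ℝ s := by
  have hC : ∀ (a : ℝ) {p : MvPolynomial σ ℝ}, p ∈ supported ℝ s → C a * p ∈ supported ℝ s :=
    fun a p hp => Subalgebra.mul_mem _ (Subalgebra.algebraMap_mem _ a) hp
  have h4 : (4 : MvPolynomial σ ℝ) = C 4 := (map_ofNat C 4).symm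
  have hS := sub_mem (add_mem hN hD) hM
  refine sub_mem (hC _ (sub_mem ?_ (pow_mem hS 2)))
    (pow_mem (sub_mem (sub_mem (add_mem hN (hC _ hD)) (hC _ hS)) hL) 2)
  rw [h4]
  exact hC _ (Subalgebra.mul_mem _ hN hD)

end Forms

/-! ### Four ends: linear relations and quartics in the absolute values. -/

section Ends

variable {n : ℕ} {ℓ : Set (Torus n)} {ι : ends ℓ → Fin (n + 1)} {e₁ e₂ e₃ : ends ℓ}

theorem FourEnds.exists_eq (F : FourEnds ℓ) : ∃ a b c d : ends ℓ, a ≠ b ∧ a ≠ c ∧ a ≠ d ∧ b ≠ c ∧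
    b ≠ d ∧ c ≠ d ∧ ∀ e, e ∈ F.1 ↔ e = a ∨ e = b ∨ e = c ∨ e = d := by
  classical
  obtain ⟨a, s, ha, hs, hcard⟩ := Finset.card_eq_succ.1 F.2
  obtain ⟨b, c, d, hbc, hbd, hcd, rfl⟩ := Finset.card_eq_three.1 hcard
  simp only [Finset.mem_insert, Finset.mem_singleton, not_or] at ha
  exact ⟨a, b, c, d, ha.1, ha.2.1, ha.2.2, hbc, hbd, hcd, fun e => by rw [← hs]; simp⟩

theorem exists_fourEnds {a b c d : ends ℓ} (hab : a ≠ b) (hac : a ≠ c) (had : a ≠ d) (hbc : b ≠ c)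
    (hbd : b ≠ d) (hcd : c ≠ d) :
    ∃ F : FourEnds ℓ, ∀ e, e ∈ F.1 ↔ e = a ∨ e = b ∨ e = c ∨ e = d := by
  classical
  refine ⟨⟨{a, b, c, d}, ?_⟩, fun e => by simp⟩
  rw [Finset.card_eq_succ]
  exact ⟨a, {b, c, d}, by simp [hab, hac, had], rfl,
    Finset.card_eq_three.2 ⟨b, c, d, hbc, hbd, hcd, rfl⟩⟩

theorem sum_four {a b c d : ends ℓ} (hab : a ≠ b) (hac : a ≠ c) (had : a ≠ d) (hbc : b ≠ c)
    (hbd : b ≠ d) (hcd : c ≠ d) {F : Finset (ends ℓ)}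
    (hF : ∀ e, e ∈ F ↔ e = a ∨ e = b ∨ e = c ∨ e = d) (f : ends ℓ → ℝ) :
    ∑ e ∈ F, f e = f a + f b + f c + f d := by
  classical
  have : F = {a, b, c, d} := by ext e; simp [hF]
  rw [this, Finset.sum_insert (by simp [hab, hac, had]), Finset.sum_insert (by simp [hbc, hbd]),
    Finset.sum_pair hcd]
  ring

theorem Chart.concyclic_iff (c : Chart ℓ e₁ e₂ e₃) {d : ends ℓ} (hd : d ≠ e₁) {F : FourEnds ℓ}
    (hF : ∀ e, e ∈ F.1 ↔ e = e₁ ∨ e = e₂ ∨ e = e₃ ∨ e = d) : Concyclic F ↔ (c.z d).im = 0 := by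
  rw [← c.mem_circle_iff hd]
  constructor
  · rintro ⟨C, hC, h⟩
    rw [← c.eq_circle hC (h _ ((hF _).2 (by simp))) (h _ ((hF _).2 (by simp)))
      (h _ ((hF _).2 (by simp)))]
    exact h _ ((hF _).2 (by simp))
  · intro h
    refine ⟨_, c.isCircle_circle, fun e he => ?_⟩
    rcases (hF e).1 he with rfl | rfl | rfl | rfl
    · exact c.mem_circle_one
    · exact c.mem_circle_two
    · exact c.mem_circle_three
    · exact h

theorem Chart.z_ne_zero (c : Chart ℓ e₁ e₂ e₃) {d : ends ℓ} (h₁ : d ≠ e₁) (h₂ : d ≠ e₂) :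
    c.z d ≠ 0 := fun h => h₂ (c.z_inj h₁ c.ne₁₂.symm (h.trans c.z₂.symm))

theorem Chart.z_ne_one (c : Chart ℓ e₁ e₂ e₃) {d : ends ℓ} (h₁ : d ≠ e₁) (h₃ : d ≠ e₃) :
    c.z d ≠ 1 := fun h => h₃ (c.z_inj h₁ c.ne₁₃.symm (h.trans c.z₃.symm))

/-- Four concyclic ends give a linear relation between the squares of the absolute values. -/
theorem IsLine.exists_relation (hℓ : IsLine ℓ) (hι : IsEndCoordinate ℓ ι) {F : FourEnds ℓ}
    (hF : Concyclic F) : ∃ k : ends ℓ → ℝ, (∀ e ∈ F.1, k e ≠ 0) ∧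
      ∀ w ∈ cone ℓ, ∑ e ∈ F.1, k e * ‖w (ι e)‖ ^ 2 = 0 := by
  classical
  obtain ⟨e₁, e₂, e₃, d, h12, h13, h1d, h23, h2d, h3d, hFe⟩ := F.exists_eq
  obtain ⟨c⟩ := hℓ.nonempty_chart h12 h13 h23
  have him := (c.concyclic_iff h1d.symm hFe).1 hF
  set ω := (c.z d).re with hω
  have hz : c.z d = ω := Complex.ext (by simp [hω]) (by simp [him])
  have h0 : ω ≠ 0 := fun h => c.z_ne_zero h1d.symm h2d.symm (by simp [hz, h])
  have h1 : ω - 1 ≠ 0 := fun h => c.z_ne_one h1d.symm h3d.symm (by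
    rw [hz, sub_eq_zero.1 h, Complex.ofReal_one])
  -- Eliminating 2 Re(s t̄) = |s|² + |t|² - |s - t|² from |s - ωt|² gives ω(ω-1)|t|² - (ω-1)|s|² +
  -- ω|s-t|² - |s-ωt|² = 0 for real ω. The coefficients are nonzero because ω ≠ 0, 1.
  refine ⟨fun e => (‖c.κ ι e‖ ^ 2)⁻¹ * (if e = e₁ then ω * (ω - 1) else if e = e₂ then -(ω - 1) else
    if e = e₃ then ω else -1), ?_, ?_⟩
  · intro e _
    refine mul_ne_zero (inv_ne_zero (pow_ne_zero 2 (c.norm_coord_pos hℓ hι e).ne')) ?_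
    split_ifs
    · exact mul_ne_zero h0 h1
    · exact neg_ne_zero.2 h1
    · exact h0
    · norm_num
  · intro w hw
    obtain ⟨s, t, rfl⟩ := c.spans.mem_cone_iff.1 hw
    have key : ∀ (e : ends ℓ) (q : ℝ), (‖c.κ ι e‖ ^ 2)⁻¹ * q * ‖(s • c.w₁ + t • c.w₂) (ι e)‖ ^ 2 =
        q * ‖c.form e s t‖ ^ 2 := by
      intro e q
      have := (c.norm_coord_pos hℓ hι e).ne'
      rw [c.norm_apply hι]
      field_simp
    rw [sum_four h12 h13 h1d h23 h2d h3d hFe]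
    simp only [key, if_pos, h12.symm, h13.symm, h1d.symm, h23.symm, h2d.symm, h3d.symm, if_false]
    rw [c.form_one, c.form_two, c.form_three, c.form_of_ne h1d.symm, hz]
    simp only [Complex.sq_norm, Complex.normSq_apply, Complex.sub_re, Complex.sub_im,
      Complex.mul_re, Complex.mul_im, Complex.ofReal_re, Complex.ofReal_im]
    ring

/-- The value at an end of the functional on Hermitian forms with coefficients `D`, `N`, `P`, `I`. -/
noncomputable def Chart.herm (c : Chart ℓ e₁ e₂ e₃) (D N P I : ℝ) (e : ends ℓ) : ℝ :=
  open Classical in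
  if e = e₁ then D else N - 2 * (P * (c.z e).re + I * (c.z e).im) + Complex.normSq (c.z e) * D

/-- Squared absolute values are linear in the rank-one Hermitian matrix of (s, t); this turns
equations for the amoeba into linear algebra plus a rank condition. -/
theorem Chart.sq_norm_form (c : Chart ℓ e₁ e₂ e₃) (e : ends ℓ) (s t : ℂ) :
    ‖c.form e s t‖ ^ 2 = c.herm (Complex.normSq t) (Complex.normSq s)
      (s * starRingEnd ℂ t).re (s * starRingEnd ℂ t).im e := by
  by_cases he : e = e₁
  · rw [he, c.form_one, herm, if_pos rfl, Complex.sq_norm]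
  · rw [c.form_of_ne he, herm, if_neg he]
    simp only [Complex.sq_norm, Complex.normSq_apply, Complex.sub_re, Complex.sub_im,
      Complex.mul_re, Complex.mul_im, Complex.conj_re, Complex.conj_im]
    ring

/-- The span of the vectors of squared absolute values of the chosen coordinates. -/
def squareSpan (ℓ : Set (Torus n)) (ι : ends ℓ → Fin (n + 1)) : Submodule ℝ (ends ℓ → ℝ) :=
  Submodule.span ℝ {ρ | ∃ w ∈ cone ℓ, ρ = fun e => ‖w (ι e)‖ ^ 2}

theorem sq_norm_mem_squareSpan {w : Fin (n + 1) → ℂ} (hw : w ∈ cone ℓ) :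
    (fun e => ‖w (ι e)‖ ^ 2) ∈ squareSpan ℓ ι := Submodule.subset_span ⟨w, hw, rfl⟩

/-- The span of the vectors of squares is a linear image of the Hermitian matrices, so it has
dimension at most four. -/
theorem Chart.exists_herm_of_mem_squareSpan (c : Chart ℓ e₁ e₂ e₃) (hι : IsEndCoordinate ℓ ι)
    {ρ : ends ℓ → ℝ} (hρ : ρ ∈ squareSpan ℓ ι) :
    ∃ D N P I : ℝ, ∀ e, ρ e = ‖c.κ ι e‖ ^ 2 * c.herm D N P I e := by
  induction hρ using Submodule.span_induction with
  | mem ρ h =>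
    obtain ⟨w, hw, rfl⟩ := h
    obtain ⟨s, t, rfl⟩ := c.spans.mem_cone_iff.1 hw
    exact ⟨_, _, _, _, fun e => by simp only [c.norm_apply hι, mul_pow, c.sq_norm_form]; rfl⟩
  | zero => exact ⟨0, 0, 0, 0, fun e => by simp [herm]⟩
  | add ρ ρ' _ _ h h' =>
    obtain ⟨D, N, P, I, h⟩ := h
    obtain ⟨D', N', P', I', h'⟩ := h'
    refine ⟨D + D', N + N', P + P', I + I', fun e => ?_⟩
    rw [Pi.add_apply, h, h']
    simp only [herm]
    split_ifs <;> ring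
  | smul a ρ _ h =>
    obtain ⟨D, N, P, I, h⟩ := h
    refine ⟨a * D, a * N, a * P, a * I, fun e => ?_⟩
    rw [Pi.smul_apply, h, smul_eq_mul]
    simp only [herm]
    split_ifs <;> ring

theorem Chart.herm_one (c : Chart ℓ e₁ e₂ e₃) (D N P I : ℝ) : c.herm D N P I e₁ = D := if_pos rfl

theorem Chart.herm_of_ne (c : Chart ℓ e₁ e₂ e₃) (D N P I : ℝ) {e : ends ℓ} (he : e ≠ e₁) :
    c.herm D N P I e = N - 2 * (P * (c.z e).re + I * (c.z e).im) + Complex.normSq (c.z e) * D :=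
  if_neg he

theorem Chart.herm_two (c : Chart ℓ e₁ e₂ e₃) (D N P I : ℝ) : c.herm D N P I e₂ = N := by
  rw [c.herm_of_ne _ _ _ _ c.ne₁₂.symm, c.z₂]; simp

theorem Chart.herm_three (c : Chart ℓ e₁ e₂ e₃) (D N P I : ℝ) :
    c.herm D N P I e₃ = N - 2 * P + D := by
  rw [c.herm_of_ne _ _ _ _ c.ne₁₃.symm, c.z₃]; simp

/-- The squares of the absolute values are determined by those at four ends that are not
concyclic. -/
theorem IsLine.eq_zero_of_mem_squareSpan (hℓ : IsLine ℓ) (hι : IsEndCoordinate ℓ ι) {F : FourEnds ℓ}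
    (hF : ¬ Concyclic F) {ρ : ends ℓ → ℝ} (hρ : ρ ∈ squareSpan ℓ ι) (h : ∀ e ∈ F.1, ρ e = 0) :
    ρ = 0 := by
  obtain ⟨e₁, e₂, e₃, d, h12, h13, h1d, h23, h2d, h3d, hFe⟩ := F.exists_eq
  obtain ⟨c⟩ := hℓ.nonempty_chart h12 h13 h23
  have him := fun h => hF ((c.concyclic_iff h1d.symm hFe).2 h)
  obtain ⟨D, N, P, I, hH⟩ := c.exists_herm_of_mem_squareSpan hι hρ
  have h' : ∀ e ∈ F.1, c.herm D N P I e = 0 := fun e he => by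
    have h0 := h e he
    rw [hH] at h0
    exact (mul_eq_zero.1 h0).resolve_left (pow_ne_zero 2 (c.norm_coord_pos hℓ hι e).ne')
  have hD := h' e₁ ((hFe _).2 (by simp))
  have hN := h' e₂ ((hFe _).2 (by simp))
  have hP := h' e₃ ((hFe _).2 (by simp))
  have hI := h' d ((hFe _).2 (by simp))
  rw [c.herm_one] at hD
  rw [c.herm_two] at hN
  rw [c.herm_three] at hP
  rw [c.herm_of_ne _ _ _ _ h1d.symm] at hI
  have hP' : P = 0 := by linarith
  -- The first three ends eliminate D, N and P; the fourth sees I because its position is not real.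
  have hI' : I = 0 := by
    rw [hD, hN, hP'] at hI
    have : I * (c.z d).im = 0 := by linarith
    exact (mul_eq_zero.1 this).resolve_right him
  funext e
  rw [hH, hD, hN, hP', hI']
  simp [Chart.herm]

/-- A solution of the quartic equation comes from a Hermitian form of rank one. -/
theorem exists_of_quartic_eq_zero {ω : ℂ} (hω : ω.im ≠ 0) {D N M L : ℝ} (hD : 0 < D)
    (h : ω.im ^ 2 * (4 * (N * D) - (N + D - M) ^ 2) -
        (N + Complex.normSq ω * D - ω.re * (N + D - M) - L) ^ 2 = 0) :
    ∃ s t : ℂ, ‖t‖ ^ 2 = D ∧ ‖s‖ ^ 2 = N ∧ ‖s - t‖ ^ 2 = M ∧ ‖s - ω * t‖ ^ 2 = L := by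
  obtain ⟨t, ht, rfl⟩ : ∃ t : ℝ, 0 < t ∧ t ^ 2 = D := ⟨√D, Real.sqrt_pos.2 hD, Real.sq_sqrt hD.le⟩
  -- With t = √D real and s = x + iy, the value M of |s - t|² fixes x, and then the value L of |s -
  -- ωt|² fixes y, which needs Im ω ≠ 0.
  set x := (N + t ^ 2 - M) / (2 * t) with hx
  set y := (N + Complex.normSq ω * t ^ 2 - ω.re * (N + t ^ 2 - M) - L) / (2 * t * ω.im) with hy
  have hx' : 2 * t * x = N + t ^ 2 - M := by rw [hx]; field_simp
  have hy' : 2 * t * ω.im * y = N + Complex.normSq ω * t ^ 2 - ω.re * (N + t ^ 2 - M) - L := by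
    rw [hy]; field_simp
  have hxy : x ^ 2 + y ^ 2 = N := by
    rw [← hx', ← sub_eq_zero] at h
    rw [← hx'] at hy'
    rw [← hy'] at h
    -- In terms of x and y the quartic is a nonzero multiple of N - x² - y²; its vanishing is the
    -- only remaining condition, |s|² = N.
    have : 4 * ω.im ^ 2 * t ^ 2 * (N - x ^ 2 - y ^ 2) = 0 := by linarith
    have h0 : 4 * ω.im ^ 2 * t ^ 2 ≠ 0 := by positivity
    have := (mul_eq_zero.1 this).resolve_left h0
    linarith
  refine ⟨⟨x, y⟩, t, by simp, ?_, ?_, ?_⟩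
  · rw [Complex.sq_norm, Complex.normSq_mk]; linarith
  · simp only [Complex.sq_norm, Complex.normSq_apply, Complex.sub_re, Complex.sub_im,
      Complex.ofReal_re, Complex.ofReal_im]
    linarith
  · simp only [Complex.sq_norm, Complex.normSq_apply, Complex.sub_re, Complex.sub_im,
      Complex.mul_re, Complex.mul_im, Complex.ofReal_re, Complex.ofReal_im] at hy' ⊢
    linear_combination hxy - hy' - ω.re * hx'

theorem quartic_eq_zero (ω s t : ℂ) :
    ω.im ^ 2 * (4 * (‖s‖ ^ 2 * ‖t‖ ^ 2) - (‖s‖ ^ 2 + ‖t‖ ^ 2 - ‖s - t‖ ^ 2) ^ 2) -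
      (‖s‖ ^ 2 + Complex.normSq ω * ‖t‖ ^ 2 - ω.re * (‖s‖ ^ 2 + ‖t‖ ^ 2 - ‖s - t‖ ^ 2) -
        ‖s - ω * t‖ ^ 2) ^ 2 = 0 := by
  simp only [Complex.sq_norm, Complex.normSq_apply, Complex.sub_re, Complex.sub_im,
    Complex.mul_re, Complex.mul_im]
  ring

open MvPolynomial in
/-- Four ends that are not concyclic give a quartic form in their coordinates that characterizes
the absolute values of the four coordinates on the line. -/
theorem IsLine.exists_quartic (hℓ : IsLine ℓ) (hι : IsEndCoordinate ℓ ι) {F : FourEnds ℓ}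
    (hF : ¬ Concyclic F) : ∃ Q : MvPolynomial (Fin (n + 1)) ℝ, Q.IsHomogeneous 4 ∧
      Q.vars = F.1.image ι ∧ ∀ r : Fin n → ℝ, (∀ i, 0 < homReal r i) →
        (eval (homReal r) Q = 0 ↔ ∃ w ∈ cone ℓ, ∀ e ∈ F.1, homReal r (ι e) = ‖w (ι e)‖) := by
  obtain ⟨e₁, e₂, e₃, d, h12, h13, h1d, h23, h2d, h3d, hFe⟩ := F.exists_eq
  obtain ⟨c⟩ := hℓ.nonempty_chart h12 h13 h23
  have him := fun h => hF ((c.concyclic_iff h1d.symm hFe).2 h)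
  have hω0 := Complex.normSq_pos.2 (c.z_ne_zero h1d.symm h2d.symm)
  have hω1 := Complex.normSq_pos.2 (sub_ne_zero.2 (c.z_ne_one h1d.symm h3d.symm))
  set ω := c.z d with hω
  have hinj := hℓ.endCoordinate_injective hι
  have hk : ∀ e, 0 < (‖c.κ ι e‖ ^ 2)⁻¹ := fun e => inv_pos.2 (pow_pos (c.norm_coord_pos hℓ hι e) 2)
  let T : ends ℓ → MvPolynomial (Fin (n + 1)) ℝ := fun e => sqTerm (‖c.κ ι e‖ ^ 2)⁻¹ (ι e)
  have hT : ∀ e, (T e).IsHomogeneous 2 := fun e => isHomogeneous_sqTerm _ _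
  have hTs : ∀ e ∈ F.1, T e ∈ supported ℝ (F.1.image ι : Set (Fin (n + 1))) := fun e he =>
    sqTerm_mem_supported _ (Finset.mem_coe.2 (Finset.mem_image_of_mem _ he))
  have hT1 : ∀ e, eval (Pi.single (ι e) 1) (T e) = (‖c.κ ι e‖ ^ 2)⁻¹ := fun e => by simp [T]
  have hT0 : ∀ e f, f ≠ e → eval (Pi.single (ι e) 1) (T f) = 0 := fun e f h => by
    simp [T, Pi.single_eq_of_ne (hinj.ne h)]
  have m₁ : e₁ ∈ F.1 := (hFe _).2 (by simp)
  have m₂ : e₂ ∈ F.1 := (hFe _).2 (by simp)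
  have m₃ : e₃ ∈ F.1 := (hFe _).2 (by simp)
  have m₄ : d ∈ F.1 := (hFe _).2 (by simp)
  refine ⟨quarticForm ω (T e₁) (T e₂) (T e₃) (T d),
    isHomogeneous_quarticForm _ (hT _) (hT _) (hT _) (hT _),
    vars_eq_image_of_supported (quarticForm_mem_supported _ (hTs _ m₁) (hTs _ m₂) (hTs _ m₃)
      (hTs _ m₄)) ?_, ?_⟩
  · intro e he
    have hz : eval (0 : Fin (n + 1) → ℝ) (quarticForm ω (T e₁) (T e₂) (T e₃) (T d)) = 0 := by
      have hTz : ∀ e, eval (0 : Fin (n + 1) → ℝ) (T e) = 0 := fun e =>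
        (eval_sqTerm _ _ _).trans (by simp)
      rw [eval_quarticForm, hTz, hTz, hTz, hTz]
      ring
    rw [hz, eval_quarticForm]
    simp only [Complex.normSq_apply, Complex.sub_re, Complex.sub_im, Complex.one_re,
      Complex.one_im, sub_zero] at hω0 hω1 ⊢
    have hke := hk e
    -- The coefficients of D², N², M², L² in the quartic are -|ω|²|ω-1|², -|ω-1|², -|ω|², -1. None
    -- vanishes, so all four coordinates occur.
    rcases (hFe e).1 he with rfl | rfl | rfl | rfl
    · rw [hT1, hT0 _ _ h12.symm, hT0 _ _ h13.symm, hT0 _ _ h1d.symm]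
      have := mul_pos (mul_pos hω0 hω1) (mul_pos hke hke)
      exact fun h => this.ne' (by linear_combination -h)
    · rw [hT1, hT0 _ _ h12, hT0 _ _ h23.symm, hT0 _ _ h2d.symm]
      have := mul_pos hω1 (mul_pos hke hke)
      exact fun h => this.ne' (by linear_combination -h)
    · rw [hT1, hT0 _ _ h13, hT0 _ _ h23, hT0 _ _ h3d.symm]
      have := mul_pos hω0 (mul_pos hke hke)
      exact fun h => this.ne' (by linear_combination -h)
    · rw [hT1, hT0 _ _ h1d, hT0 _ _ h2d, hT0 _ _ h3d]
      have := mul_pos hke hke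
      exact fun h => this.ne' (by linear_combination -h)
  · intro r hr
    have hTe : ∀ e, eval (homReal r) (T e) = (‖c.κ ι e‖ ^ 2)⁻¹ * homReal r (ι e) ^ 2 := fun e => by
      simp [T]
    have hiff : ∀ (e : ends ℓ) (s t : ℂ), homReal r (ι e) = ‖(s • c.w₁ + t • c.w₂) (ι e)‖ ↔
        ‖c.form e s t‖ ^ 2 = eval (homReal r) (T e) := by
      intro e s t
      have hκ := c.norm_coord_pos hℓ hι e
      rw [hTe, c.norm_apply hι, ← sq_eq_sq₀ (hr _).le (by positivity), mul_pow,
        eq_inv_mul_iff_mul_eq₀ (pow_pos hκ 2).ne', eq_comm]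
    rw [eval_quarticForm]
    constructor
    · intro h
      obtain ⟨s, t, h1, h2, h3, h4⟩ := exists_of_quartic_eq_zero him (by
        rw [hTe]; exact mul_pos (hk _) (pow_pos (hr _) 2)) h
      refine ⟨_, c.spans.mem_cone_iff.2 ⟨s, t, rfl⟩, fun e he => (hiff _ _ _).2 ?_⟩
      rcases (hFe e).1 he with rfl | rfl | rfl | rfl
      · rw [c.form_one, h1]
      · rw [c.form_two, h2]
      · rw [c.form_three, h3]
      · rw [c.form_of_ne h1d.symm, ← hω, h4]
    · rintro ⟨w, hw, hwr⟩
      obtain ⟨s, t, rfl⟩ := c.spans.mem_cone_iff.1 hw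
      rw [← (hiff _ _ _).1 (hwr _ m₁), ← (hiff _ _ _).1 (hwr _ m₂), ← (hiff _ _ _).1 (hwr _ m₃),
        ← (hiff _ _ _).1 (hwr _ m₄), c.form_one, c.form_two, c.form_three,
        c.form_of_ne h1d.symm, ← hω]
      exact quartic_eq_zero ω s t

end Ends

/-! ### Real lines: the quadrics and the surface that they cut out. -/

section Equations

open MvPolynomial

variable {n : ℕ} {ℓ : Set (Torus n)} {ι : ends ℓ → Fin (n + 1)} {e₁ e₂ e₃ : ends ℓ}

theorem eq_at_fourth {a b c d : ends ℓ} (hab : a ≠ b) (hac : a ≠ c) (had : a ≠ d) (hbc : b ≠ c)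
    (hbd : b ≠ d) (hcd : c ≠ d) {F : FourEnds ℓ}
    (hF : ∀ e, e ∈ F.1 ↔ e = a ∨ e = b ∨ e = c ∨ e = d) {k ρ σ : ends ℓ → ℝ}
    (hk : ∀ e ∈ F.1, k e ≠ 0) (hρ : ∑ e ∈ F.1, k e * ρ e = 0) (hσ : ∑ e ∈ F.1, k e * σ e = 0)
    (ha : ρ a = σ a) (hb : ρ b = σ b) (hc : ρ c = σ c) : ρ d = σ d := by
  rw [sum_four hab hac had hbc hbd hcd hF] at hρ hσ
  rw [ha, hb, hc] at hρ
  exact mul_left_cancel₀ (hk d ((hF _).2 (by simp))) (by linarith)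

/-- A vector that satisfies all four-term relations is determined by three of its entries. -/
theorem eq_of_relations (h12 : e₁ ≠ e₂) (h13 : e₁ ≠ e₃) (h23 : e₂ ≠ e₃)
    {k : FourEnds ℓ → ends ℓ → ℝ} (hk : ∀ F, ∀ e ∈ F.1, k F e ≠ 0) {ρ σ : ends ℓ → ℝ}
    (hρ : ∀ F, ∑ e ∈ F.1, k F e * ρ e = 0) (hσ : ∀ F, ∑ e ∈ F.1, k F e * σ e = 0)
    (h₁ : ρ e₁ = σ e₁) (h₂ : ρ e₂ = σ e₂) (h₃ : ρ e₃ = σ e₃) (e : ends ℓ) : ρ e = σ e := by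
  by_cases he1 : e₁ = e
  · exact he1 ▸ h₁
  by_cases he2 : e₂ = e
  · exact he2 ▸ h₂
  by_cases he3 : e₃ = e
  · exact he3 ▸ h₃
  obtain ⟨F, hF⟩ := exists_fourEnds h12 h13 he1 h23 he2 he3
  exact eq_at_fourth h12 h13 he1 h23 he2 he3 hF (hk F) (hρ F) (hσ F) h₁ h₂ h₃

theorem planarInequalities_of_mem {x : Torus n} (hx : x ∈ ℓ) : PlanarInequalities ℓ ι (absMap x) := by
  intro e f g _ _ _ a b c _ _ _ h
  simp only [homReal_absMap, ← norm_mul]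
  exact triangleIneq_of_add_eq_zero (h x hx)

/-- The planar inequality for the three ends of the chart yields a vector with the right absolute
values there, and the relations propagate the equality to all other ends. -/
theorem IsLine.algAmoeba_eq_of_relations (hℓ : IsLine ℓ) (hι : IsEndCoordinate ℓ ι)
    (c : Chart ℓ e₁ e₂ e₃) {k : FourEnds ℓ → ends ℓ → ℝ} (hk : ∀ F, ∀ e ∈ F.1, k F e ≠ 0)
    (hrel : ∀ F, ∀ w ∈ cone ℓ, ∑ e ∈ F.1, k F e * ‖w (ι e)‖ ^ 2 = 0) :
    algAmoeba ℓ = {r ∈ cutOut ℓ (fun F => diagForm F.1 ι (k F)) | PlanarInequalities ℓ ι r} := by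
  refine Set.Subset.antisymm ?_ ?_
  · rintro _ ⟨x, hx, rfl⟩
    refine ⟨⟨⟨x, hℓ.subset_affineTorus hx, rfl⟩, fun F => ?_⟩, planarInequalities_of_mem hx⟩
    rw [eval_diagForm, ← hrel F _ (hom_mem_cone hx)]
    simp only [homReal_absMap]
  · rintro r ⟨⟨hr, hQ⟩, hp⟩
    simp only [eval_diagForm] at hQ
    have hκ := c.κ_ne_zero hℓ hι
    have hpos := homReal_pos_of_mem hr
    obtain ⟨s, t, h1, h2, h3⟩ := c.exists_norm_eq hℓ hι (R := fun e => homReal r (ι e))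
      (fun e => hpos _) (hp e₁ e₂ e₃ c.ne₁₂ c.ne₁₃ c.ne₂₃ _ _ _ (inv_ne_zero (hκ _))
        (neg_ne_zero.2 (inv_ne_zero (hκ _))) (inv_ne_zero (hκ _))
        fun x hx => c.planar_relation hℓ hι hx)
    refine (hℓ.mem_algAmoeba_iff_cone hι hr).2
      ⟨_, c.spans.mem_cone_iff.2 ⟨s, t, rfl⟩, fun e => ?_⟩
    rw [← sq_eq_sq₀ (hpos _).le (norm_nonneg _)]
    refine eq_of_relations (ρ := fun e => homReal r (ι e) ^ 2)
      (σ := fun e => ‖(s • c.w₁ + t • c.w₂) (ι e)‖ ^ 2) c.ne₁₂ c.ne₁₃ c.ne₂₃ hk hQ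
      (fun F => hrel F _ (c.spans.mem_cone_iff.2 ⟨s, t, rfl⟩)) ?_ ?_ ?_ e
    · simp only [c.norm_apply hι, ← norm_mul, h1]
    · simp only [c.norm_apply hι, ← norm_mul, h2]
    · simp only [c.norm_apply hι, ← norm_mul, h3]

/-- The solutions of the four-term relations have arbitrary entries at three ends. -/
theorem Chart.exists_dual (c : Chart ℓ e₁ e₂ e₃) (hℓ : IsLine ℓ) (hι : IsEndCoordinate ℓ ι)
    {k : FourEnds ℓ → ends ℓ → ℝ}
    (hrel : ∀ F, ∀ w ∈ cone ℓ, ∑ e ∈ F.1, k F e * ‖w (ι e)‖ ^ 2 = 0) :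
    ∃ L : ℝ → ℝ → ℝ → ends ℓ → ℝ, (∀ x y z F, ∑ e ∈ F.1, k F e * L x y z e = 0) ∧
      (∀ x y z, L x y z e₁ = x) ∧ (∀ x y z, L x y z e₂ = y) ∧ (∀ x y z, L x y z e₃ = z) ∧
      ∃ α β γ : ends ℓ → ℝ, ∀ x y z e, L x y z e = x * α e + y * β e + z * γ e := by
  have hκ := fun e => (c.norm_coord_pos hℓ hι e).ne'
  have hA := c.norm_apply hι
  -- The vectors of squares over ∞, 0, 1. At the three ends of the chart each vanishes at its own
  -- end and equals the squared constant at the other two, so B + G - A and its analogues form a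
  -- dual basis up to scale.
  let A : ends ℓ → ℝ := fun e => ‖((1 : ℂ) • c.w₁ + (0 : ℂ) • c.w₂) (ι e)‖ ^ 2
  let B : ends ℓ → ℝ := fun e => ‖((0 : ℂ) • c.w₁ + (1 : ℂ) • c.w₂) (ι e)‖ ^ 2
  let G : ends ℓ → ℝ := fun e => ‖((1 : ℂ) • c.w₁ + (1 : ℂ) • c.w₂) (ι e)‖ ^ 2
  have hrA : ∀ F, ∑ e ∈ F.1, k F e * A e = 0 := fun F =>
    hrel F _ (c.spans.mem_cone_iff.2 ⟨1, 0, rfl⟩)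
  have hrB : ∀ F, ∑ e ∈ F.1, k F e * B e = 0 := fun F =>
    hrel F _ (c.spans.mem_cone_iff.2 ⟨0, 1, rfl⟩)
  have hrG : ∀ F, ∑ e ∈ F.1, k F e * G e = 0 := fun F =>
    hrel F _ (c.spans.mem_cone_iff.2 ⟨1, 1, rfl⟩)
  let α : ends ℓ → ℝ := fun e => (2 * ‖c.κ ι e₁‖ ^ 2)⁻¹ * (B e + G e - A e)
  let β : ends ℓ → ℝ := fun e => (2 * ‖c.κ ι e₂‖ ^ 2)⁻¹ * (A e + G e - B e)
  let γ : ends ℓ → ℝ := fun e => (2 * ‖c.κ ι e₃‖ ^ 2)⁻¹ * (A e + B e - G e)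
  have h1 := hκ e₁
  have h2 := hκ e₂
  have h3 := hκ e₃
  refine ⟨fun x y z e => x * α e + y * β e + z * γ e, fun x y z F => ?_, fun x y z => ?_,
    fun x y z => ?_, fun x y z => ?_, α, β, γ, fun _ _ _ _ => rfl⟩
  · have : ∀ e, k F e * (x * α e + y * β e + z * γ e) =
        (-x * (2 * ‖c.κ ι e₁‖ ^ 2)⁻¹ + y * (2 * ‖c.κ ι e₂‖ ^ 2)⁻¹ + z * (2 * ‖c.κ ι e₃‖ ^ 2)⁻¹) *
          (k F e * A e) +
        (x * (2 * ‖c.κ ι e₁‖ ^ 2)⁻¹ - y * (2 * ‖c.κ ι e₂‖ ^ 2)⁻¹ + z * (2 * ‖c.κ ι e₃‖ ^ 2)⁻¹) *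
          (k F e * B e) +
        (x * (2 * ‖c.κ ι e₁‖ ^ 2)⁻¹ + y * (2 * ‖c.κ ι e₂‖ ^ 2)⁻¹ - z * (2 * ‖c.κ ι e₃‖ ^ 2)⁻¹) *
          (k F e * G e) := fun e => by simp only [α, β, γ]; ring
    simp only [this, Finset.sum_add_distrib, ← Finset.mul_sum, hrA, hrB, hrG]
    ring
  · simp only [α, β, γ, A, B, G, hA, c.form_one, norm_one, norm_zero]
    field_simp; ring
  · simp only [α, β, γ, A, B, G, hA, c.form_two, norm_one, norm_zero]
    field_simp; ring
  · simp only [α, β, γ, A, B, G, hA, c.form_three, sub_zero, zero_sub, sub_self, norm_neg,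
      norm_one, norm_zero]
    field_simp; ring

theorem IsLine.homReal_eq_of_mem (hℓ : IsLine ℓ) (hι : IsEndCoordinate ℓ ι) {a : Torus n}
    (ha : a ∈ ℓ) {r : Fin n → ℝ} (hr : r ∈ algAmoeba (affineTorus ℓ)) (i : Fin (n + 1)) :
    homReal r i =
      homReal r (ι (hℓ.endOf i)) * (‖hom a i‖ / ‖hom a (ι (hℓ.endOf i))‖) := by
  obtain ⟨x, hx, rfl⟩ := hr
  have h := congrArg norm ((hℓ.mem_affineTorus_iff ha).1 hx i (ι (hℓ.endOf i))
    (hℓ.endOf_apply hι _).symm)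
  rw [norm_mul, norm_mul] at h
  rw [homReal_absMap, homReal_absMap, ← mul_div_assoc, eq_div_iff (by simp [hom_apply_ne_zero]), h]

/-- Positive values at the ends extend to all coordinates through the ratios of the base point;
division by `T 0` restores x₀ = 1. -/
theorem IsLine.exists_mem_algAmoeba (hℓ : IsLine ℓ) (hι : IsEndCoordinate ℓ ι) {a : Torus n}
    (ha : a ∈ ℓ) {R : ends ℓ → ℝ} (hR : ∀ e, 0 < R e) :
    let T : Fin (n + 1) → ℝ := fun i =>
      R (hℓ.endOf i) * (‖hom a i‖ / ‖hom a (ι (hℓ.endOf i))‖)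
    (fun i : Fin n => T i.succ / T 0) ∈ algAmoeba (affineTorus ℓ) ∧
      ∀ e, homReal (fun i : Fin n => T i.succ / T 0) (ι e) = R e / T 0 := by
  intro T
  obtain ⟨x, hx, c, hc, hxc⟩ := hℓ.exists_mem_affineTorus ι ha (fun e => (R e : ℂ))
    (fun e => by exact_mod_cast (hR e).ne')
  have hxT : ∀ i, ‖hom x i‖ = ‖c‖ * T i := by
    intro i
    rw [hxc, norm_mul, norm_mul, norm_div, Complex.norm_of_nonneg (hR _).le]
  have h0 : ‖c‖ * T 0 = 1 := by rw [← hxT, hom_zero, norm_one]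
  have hT0 : T 0 ≠ 0 := right_ne_zero_of_mul (h0 ▸ one_ne_zero)
  have hc' : ‖c‖ = (T 0)⁻¹ := eq_inv_of_mul_eq_one_left h0
  have heq : absMap x = fun i : Fin n => T i.succ / T 0 := by
    funext i
    rw [absMap, ← hom_succ, hxT, hc', inv_mul_eq_div]
  refine ⟨heq ▸ ⟨x, hx, rfl⟩, fun e => ?_⟩
  rw [← heq, homReal_absMap, hxT, hc', inv_mul_eq_div]
  simp only [T, hℓ.endOf_apply hι]
  rw [div_self (norm_ne_zero_iff.2 (hom_apply_ne_zero _ _)), mul_one]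

theorem continuous_homReal_apply (i : Fin (n + 1)) :
    Continuous fun r : Fin n → ℝ => homReal r i := by
  refine Fin.cases ?_ (fun j => ?_) i
  · exact continuous_const
  · exact continuous_apply j

/-- The quadrics of a real line cut out a surface in the amoeba of the affine torus. -/
theorem IsLine.nonempty_chartedSpace (hℓ : IsLine ℓ) (hι : IsEndCoordinate ℓ ι)
    (c : Chart ℓ e₁ e₂ e₃) {k : FourEnds ℓ → ends ℓ → ℝ} (hk : ∀ F, ∀ e ∈ F.1, k F e ≠ 0)
    (hrel : ∀ F, ∀ w ∈ cone ℓ, ∑ e ∈ F.1, k F e * ‖w (ι e)‖ ^ 2 = 0) :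
    Nonempty (ChartedSpace (EuclideanSpace ℝ (Fin 2))
      (cutOut ℓ (fun F => diagForm F.1 ι (k F)))) := by
  obtain ⟨a, ha⟩ := hℓ.nonempty
  obtain ⟨L, hL, hL₁, hL₂, hL₃, α, β, γ, hLlin⟩ := c.exists_dual hℓ hι hrel
  have := hℓ.finite_ends
  set S := cutOut ℓ (fun F => diagForm F.1 ι (k F)) with hS
  have hpos : ∀ r : S, ∀ i, 0 < homReal r.1 i := fun r => homReal_pos_of_mem r.2.1
  have hne : ∀ r : S, homReal r.1 (ι e₁) ≠ 0 := fun r => (hpos r _).ne'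
  -- Scaled to have entry 1 at e₁, the vector of squares is a solution of the relations, hence
  -- determined by its entries at e₂ and e₃.
  have hsolve : ∀ r : S, ∀ e, L 1 (homReal r.1 (ι e₂) ^ 2 / homReal r.1 (ι e₁) ^ 2)
      (homReal r.1 (ι e₃) ^ 2 / homReal r.1 (ι e₁) ^ 2) e =
        homReal r.1 (ι e) ^ 2 / homReal r.1 (ι e₁) ^ 2 := by
    intro r
    refine eq_of_relations (σ := fun e => homReal r.1 (ι e) ^ 2 / homReal r.1 (ι e₁) ^ 2)
      c.ne₁₂ c.ne₁₃ c.ne₂₃ hk (hL _ _ _) (fun F => ?_) ?_ ?_ ?_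
    · have := r.2.2 F
      rw [eval_diagForm] at this
      simp only [← mul_div_assoc, ← Finset.sum_div, this, zero_div]
    · rw [hL₁, div_self (pow_ne_zero 2 (hne r))]
    · rw [hL₂]
    · rw [hL₃]
  -- Finitely many strict affine-linear inequalities: all the squares that the two parameters
  -- determine must be positive.
  let U : Set (EuclideanSpace ℝ (Fin 2)) := {p | ∀ e, 0 < L 1 (p 0) (p 1) e}
  have hLcont : ∀ e, Continuous fun p : EuclideanSpace ℝ (Fin 2) => L 1 (p 0) (p 1) e := by
    intro e
    simp only [hLlin]
    fun_prop
  have hU : IsOpen U := by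
    have : U = ⋂ e, {p | 0 < L 1 (p 0) (p 1) e} := by ext p; simp [U]
    rw [this]
    exact isOpen_iInter_of_finite fun e => isOpen_lt continuous_const (hLcont e)
  let T : EuclideanSpace ℝ (Fin 2) → Fin (n + 1) → ℝ := fun p i =>
    √(L 1 (p 0) (p 1) (hℓ.endOf i)) * (‖hom a i‖ / ‖hom a (ι (hℓ.endOf i))‖)
  have hTpos : ∀ p ∈ U, ∀ i, 0 < T p i := fun p hp i => mul_pos (Real.sqrt_pos.2 (hp _))
    (div_pos (norm_pos_iff.2 (hom_apply_ne_zero _ _)) (norm_pos_iff.2 (hom_apply_ne_zero _ _)))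
  have hTcont : ∀ i, Continuous fun p => T p i := fun i =>
    (Real.continuous_sqrt.comp (hLcont _)).mul continuous_const
  have hmem := fun p (hp : p ∈ U) => hℓ.exists_mem_algAmoeba hι ha
    (R := fun e => √(L 1 (p 0) (p 1) e)) (fun e => Real.sqrt_pos.2 (hp e))
  have hsq : ∀ p ∈ U, ∀ e, homReal (fun i : Fin n => T p i.succ / T p 0) (ι e) ^ 2 =
      L 1 (p 0) (p 1) e / T p 0 ^ 2 := by
    intro p hp e
    rw [(hmem p hp).2 e, div_pow, Real.sq_sqrt (hp e).le]
  -- The two squared ratios are global coordinates on the surface; the inverse solves the linear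
  -- relations and takes positive square roots.
  let f : S ≃ₜ U :=
    { toFun := fun r => ⟨!₂[homReal r.1 (ι e₂) ^ 2 / homReal r.1 (ι e₁) ^ 2,
          homReal r.1 (ι e₃) ^ 2 / homReal r.1 (ι e₁) ^ 2], fun e => by
        simp only [Matrix.cons_val_zero, Matrix.cons_val_one]
        rw [hsolve]
        exact div_pos (pow_pos (hpos r _) 2) (pow_pos (hpos r _) 2)⟩
      invFun := fun p => ⟨fun i => T p.1 i.succ / T p.1 0, (hmem p.1 p.2).1, fun F => by
        rw [eval_diagForm]
        simp only [hsq p.1 p.2, ← mul_div_assoc, ← Finset.sum_div, hL, zero_div]⟩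
      left_inv := fun r => by
        have key : ∀ i, T (!₂[homReal r.1 (ι e₂) ^ 2 / homReal r.1 (ι e₁) ^ 2,
            homReal r.1 (ι e₃) ^ 2 / homReal r.1 (ι e₁) ^ 2]) i =
              homReal r.1 i / homReal r.1 (ι e₁) := by
          intro i
          simp only [T, Matrix.cons_val_zero, Matrix.cons_val_one]
          rw [hsolve, ← div_pow, Real.sqrt_sq (div_pos (hpos r _) (hpos r _)).le,
            hℓ.homReal_eq_of_mem hι ha r.2.1 i]
          ring
        apply Subtype.ext
        funext i
        simp only [key]
        rw [div_div_div_cancel_right₀ (hne r), homReal_zero, div_one, homReal_succ]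
      right_inv := fun p => by
        have h0 := (hTpos p.1 p.2 0).ne'
        apply Subtype.ext
        ext i
        fin_cases i
        · simp [hsq p.1 p.2, hL₁, hL₂, h0]
        · simp [hsq p.1 p.2, hL₁, hL₃, h0]
      continuous_toFun := by
        have hc : ∀ e, Continuous fun r : S =>
            homReal r.1 (ι e) ^ 2 / homReal r.1 (ι e₁) ^ 2 := fun e =>
          (((continuous_homReal_apply _).comp continuous_subtype_val).pow 2).div
            (((continuous_homReal_apply _).comp continuous_subtype_val).pow 2)
            fun r => pow_ne_zero 2 (hne r)
        refine Continuous.subtype_mk ((PiLp.continuous_toLp 2 _).comp (continuous_pi fun i => ?_)) _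
        fin_cases i
        · exact hc e₂
        · exact hc e₃
      continuous_invFun := by
        refine Continuous.subtype_mk (continuous_pi fun i => ?_) _
        exact ((hTcont _).comp continuous_subtype_val).div ((hTcont _).comp continuous_subtype_val)
          fun p => (hTpos p.1 p.2 0).ne' }
  have hemb := hU.isOpenEmbedding_subtypeVal.comp f.isOpenEmbedding
  have : Nonempty S := ⟨⟨absMap a, ⟨a, hℓ.subset_affineTorus ha, rfl⟩, fun F => by
    rw [eval_diagForm, ← hrel F _ (hom_mem_cone ha)]
    simp only [homReal_absMap]⟩⟩
  exact ⟨hemb.singletonChartedSpace⟩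

/-! ### Complex lines -/

/-- A subspace is the zero set of a sum of squares of linear forms in the squares of the
variables. -/
theorem exists_quartic_of_submodule {κ σ : Type*} [Fintype κ] (ι : κ → σ)
    (S : Submodule ℝ (κ → ℝ)) : ∃ Q : MvPolynomial σ ℝ, Q.IsHomogeneous 4 ∧
      Q ∈ supported ℝ (Set.range ι) ∧
      ∀ x : σ → ℝ, eval x Q = 0 ↔ (fun e => x (ι e) ^ 2) ∈ S := by
  classical
  -- A linear projection g onto S; the components of id - g are linear equations for S.
  obtain ⟨g, hg⟩ := S.subtype.exists_leftInverse_of_injective (Submodule.ker_subtype S)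
  let Ψ : (κ → ℝ) →ₗ[ℝ] (κ → ℝ) := LinearMap.id - S.subtype.comp g
  have hΨ : ∀ ρ, ρ ∈ S ↔ Ψ ρ = 0 := by
    intro ρ
    constructor
    · intro h
      have := LinearMap.congr_fun hg ⟨ρ, h⟩
      simp only [LinearMap.comp_apply, Submodule.subtype_apply, LinearMap.id_apply] at this
      simp [Ψ, this]
    · intro h
      have : ρ = g ρ := sub_eq_zero.1 h
      rw [this]; exact (g ρ).2
  refine ⟨∑ e, diagForm Finset.univ ι (fun f => Ψ (Pi.single f 1) e) ^ 2,
    IsHomogeneous.sum _ _ _ fun e _ => (isHomogeneous_diagForm _ _ _).pow 2,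
    sum_mem fun e _ => pow_mem
      (sum_mem fun f _ => sqTerm_mem_supported _ (Set.mem_range_self f)) 2, fun x => ?_⟩
  have heval : ∀ e, eval x (diagForm Finset.univ ι (fun f => Ψ (Pi.single f 1) e)) =
      Ψ (fun e => x (ι e) ^ 2) e := by
    intro e
    rw [eval_diagForm, LinearMap.pi_apply_eq_sum_univ Ψ, Finset.sum_apply]
    refine Finset.sum_congr rfl fun f _ => ?_
    have hf : (Pi.single f 1 : κ → ℝ) = fun j => if f = j then 1 else 0 := by
      funext j
      simp [Pi.single_apply, eq_comm]
    rw [Pi.smul_apply, smul_eq_mul, mul_comm, hf]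
  rw [hΨ, map_sum]
  simp only [map_pow, heval]
  -- Over ℝ a sum of squares vanishes only if every term does, so a single quartic carries all the
  -- linear equations.
  rw [Finset.sum_eq_zero_iff_of_nonneg fun _ _ => sq_nonneg _, _root_.funext_iff]
  simp

theorem Chart.exists_not_concyclic (c : Chart ℓ e₁ e₂ e₃) (h : IsComplexLine ℓ) :
    ∃ F : FourEnds ℓ, ¬ Concyclic F := by
  obtain ⟨e, he, hze⟩ := c.exists_im_ne_zero h
  have h2 : e₂ ≠ e := by rintro rfl; simp [c.z₂] at hze
  have h3 : e₃ ≠ e := by rintro rfl; simp [c.z₃] at hze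
  obtain ⟨F, hF⟩ := exists_fourEnds c.ne₁₂ c.ne₁₃ he.symm c.ne₂₃ h2 h3
  exact ⟨F, fun hc => hze ((c.concyclic_iff he hF).1 hc)⟩

/-- If only one set of four ends is not concyclic, then there are no other ends. -/
theorem IsLine.mem_of_unique_not_concyclic (hℓ : IsLine ℓ) {F₀ : FourEnds ℓ} (hF₀ : ¬ Concyclic F₀)
    (h : ∀ F, F ≠ F₀ → Concyclic F) (e : ends ℓ) : e ∈ F₀.1 := by
  by_contra he
  obtain ⟨a, b, c, d, hab, hac, had, hbc, hbd, hcd, hF⟩ := F₀.exists_eq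
  have he' := he
  rw [hF] at he'
  push Not at he'
  obtain ⟨hea, heb, hec, hed⟩ := he'
  obtain ⟨F, hF'⟩ := exists_fourEnds hab hac hea.symm hbc heb.symm hec.symm
  obtain ⟨G, hG'⟩ := exists_fourEnds hab had hea.symm hbd heb.symm hed.symm
  obtain ⟨C, hC, hCF⟩ := h F (by rintro rfl; exact he ((hF' e).2 (by simp)))
  obtain ⟨C', hC', hCG⟩ := h G (by rintro rfl; exact he ((hG' e).2 (by simp)))
  -- Both circles pass through the ends a, b, e, so they coincide; then a, b, c, d would all lie on
  -- one circle.
  have hCC : C = C' := hℓ.circle_unique hab hea.symm heb.symm hC hC'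
    (hCF _ ((hF' _).2 (by simp))) (hCF _ ((hF' _).2 (by simp))) (hCF _ ((hF' _).2 (by simp)))
    (hCG _ ((hG' _).2 (by simp))) (hCG _ ((hG' _).2 (by simp))) (hCG _ ((hG' _).2 (by simp)))
  refine hF₀ ⟨C, hC, fun f hf => ?_⟩
  rcases (hF f).1 hf with rfl | rfl | rfl | rfl
  · exact hCF _ ((hF' _).2 (by simp))
  · exact hCF _ ((hF' _).2 (by simp))
  · exact hCF _ ((hF' _).2 (by simp))
  · rw [hCC]; exact hCG _ ((hG' _).2 (by simp))

theorem FourEnds.nonempty (F : FourEnds ℓ) : F.1.Nonempty :=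
  Finset.card_pos.1 (by rw [F.2]; norm_num)

/-- Each set of four ends gives a quadric or a quartic in its four coordinates. -/
theorem IsLine.exists_form (hℓ : IsLine ℓ) (hι : IsEndCoordinate ℓ ι) (F : FourEnds ℓ) :
    ∃ Q : MvPolynomial (Fin (n + 1)) ℝ, (Concyclic F → Q.IsHomogeneous 2) ∧
      (¬ Concyclic F → Q.IsHomogeneous 4) ∧ Q.vars = F.1.image ι ∧
      (∀ r ∈ algAmoeba ℓ, eval (homReal r) Q = 0) ∧
      (¬ Concyclic F → ∀ r : Fin n → ℝ, (∀ i, 0 < homReal r i) → eval (homReal r) Q = 0 →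
        ∃ w ∈ cone ℓ, ∀ e ∈ F.1, homReal r (ι e) = ‖w (ι e)‖) := by
  by_cases hF : Concyclic F
  · obtain ⟨k, hk, hrel⟩ := hℓ.exists_relation hι hF
    refine ⟨diagForm F.1 ι k, fun _ => isHomogeneous_diagForm _ _ _, fun h => absurd hF h,
      vars_diagForm (hℓ.endCoordinate_injective hι) hk, ?_, fun h => absurd hF h⟩
    rintro _ ⟨x, hx, rfl⟩
    rw [eval_diagForm, ← hrel _ (hom_mem_cone hx)]
    simp only [homReal_absMap]
  · obtain ⟨Q, h4, hv, hQ⟩ := hℓ.exists_quartic hι hF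
    refine ⟨Q, fun h => absurd h hF, fun _ => h4, hv, fun r hr => ?_, fun _ r hr => (hQ r hr).1⟩
    refine (hQ r (homReal_pos_of_mem hr)).2 ?_
    obtain ⟨x, hx, rfl⟩ := hr
    exact ⟨_, hom_mem_cone hx, fun e _ => homReal_absMap _ _⟩

/-- The quadruple F₀ alone does not control further ends. When another non-concyclic F₁ exists, the
form of F₀ is spent on forcing the squares into their linear span, and the quartic of F₁ gives the
rank-one condition. -/
theorem IsLine.exists_equations (hℓ : IsLine ℓ) (hι : IsEndCoordinate ℓ ι) {F₀ : FourEnds ℓ}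
    (hF₀ : ¬ Concyclic F₀) : ∃ Q : FourEnds ℓ → MvPolynomial (Fin (n + 1)) ℝ,
      (∀ F, Q F ≠ 0 ∧ ((Q F).vars : Set (Fin (n + 1))) ⊆ Set.range ι ∧
        (Concyclic F → (Q F).IsHomogeneous 2) ∧ (¬ Concyclic F → (Q F).IsHomogeneous 4)) ∧
      (∀ F, F ≠ F₀ → (Q F).vars = F.1.image ι) ∧ algAmoeba ℓ = cutOut ℓ Q := by
  classical
  have := hℓ.finite_ends
  have := Fintype.ofFinite (ends ℓ)
  choose Q hQ2 hQ4 hQv hQ0 hQw using hℓ.exists_form hι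
  have hsub : algAmoeba ℓ ⊆ algAmoeba (affineTorus ℓ) := Set.image_mono hℓ.subset_affineTorus
  have hQ : ∀ F, Q F ≠ 0 ∧ ((Q F).vars : Set (Fin (n + 1))) ⊆ Set.range ι ∧
      (Concyclic F → (Q F).IsHomogeneous 2) ∧ (¬ Concyclic F → (Q F).IsHomogeneous 4) := by
    refine fun F => ⟨fun h => ?_, ?_, hQ2 F, hQ4 F⟩
    · have := hQv F
      rw [h, vars_0] at this
      exact (F.nonempty.image ι).ne_empty this.symm
    · rw [hQv F, Finset.coe_image]
      exact Set.image_subset_range _ _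
  by_cases hex : ∃ F, F ≠ F₀ ∧ ¬ Concyclic F
  · obtain ⟨F₁, hne, hF₁⟩ := hex
    obtain ⟨P, hP4, hPs, hP⟩ := exists_quartic_of_submodule ι (squareSpan ℓ ι)
    -- The unit vector at an end outside F₀ vanishes on F₀ and so lies outside the span; hence P is
    -- not the zero form.
    obtain ⟨e, heF₁, heF₀⟩ : ∃ e ∈ F₁.1, e ∉ F₀.1 := by
      by_contra! h
      exact hne (Subtype.ext (Finset.eq_of_subset_of_card_le h (by rw [F₀.2, F₁.2])))
    have hP0 : P ≠ 0 := by
      intro h0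
      have h1 := (hP (Pi.single (ι e) 1)).1 (by rw [h0, map_zero])
      have hval : ∀ f, (Pi.single (ι e) 1 : Fin (n + 1) → ℝ) (ι f) ^ 2 = if f = e then 1 else 0 := by
        intro f
        split_ifs with h
        · rw [h]; simp
        · rw [Pi.single_eq_of_ne ((hℓ.endCoordinate_injective hι).ne h)]; simp
      have h2 := congrFun (hℓ.eq_zero_of_mem_squareSpan hι hF₀ h1 fun f hf => by
        rw [hval, if_neg]; rintro rfl; exact heF₀ hf) e
      rw [hval, if_pos rfl] at h2
      exact one_ne_zero h2
    refine ⟨Function.update Q F₀ P, fun F => ?_, fun F hF => ?_, Set.Subset.antisymm ?_ ?_⟩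
    · by_cases hF : F = F₀
      · subst hF
        rw [Function.update_self]
        exact ⟨hP0, mem_supported.1 hPs, fun h => absurd h hF₀, fun _ => hP4⟩
      · rw [Function.update_of_ne hF]
        exact hQ F
    · rw [Function.update_of_ne hF]
      exact hQv F
    · refine fun r hr => ⟨hsub hr, fun F => ?_⟩
      by_cases hF : F = F₀
      · subst hF
        rw [Function.update_self, hP]
        obtain ⟨x, hx, rfl⟩ := hr
        simp only [homReal_absMap]
        exact sq_norm_mem_squareSpan (hom_mem_cone hx)
      · rw [Function.update_of_ne hF]
        exact hQ0 F r hr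
    · rintro r ⟨hr, hQr⟩
      have hpos := homReal_pos_of_mem hr
      have h₀ := hQr F₀
      have h₁ := hQr F₁
      rw [Function.update_self, hP] at h₀
      rw [Function.update_of_ne hne] at h₁
      obtain ⟨w, hw, hwr⟩ := hQw F₁ hF₁ r hpos h₁
      -- The squares of r and of w both lie in the span and agree on F₁, which determines elements
      -- of the span; so they agree at every end.
      have h := hℓ.eq_zero_of_mem_squareSpan hι hF₁ (sub_mem h₀ (sq_norm_mem_squareSpan hw))
        fun f hf => by simp only [Pi.sub_apply, hwr f hf, sub_self]
      refine (hℓ.mem_algAmoeba_iff_cone hι hr).2 ⟨w, hw, fun f => ?_⟩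
      rw [← sq_eq_sq₀ (hpos _).le (norm_nonneg _)]
      exact sub_eq_zero.1 (congrFun h f)
  · push Not at hex
    refine ⟨Q, hQ, fun F _ => hQv F, Set.Subset.antisymm
      (fun r hr => ⟨hsub hr, fun F => hQ0 F r hr⟩) ?_⟩
    rintro r ⟨hr, hQr⟩
    obtain ⟨w, hw, hwr⟩ := hQw F₀ hF₀ r (homReal_pos_of_mem hr) (hQr F₀)
    exact (hℓ.mem_algAmoeba_iff_cone hι hr).2
      ⟨w, hw, fun e => hwr e (hℓ.mem_of_unique_not_concyclic hF₀ hex e)⟩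

end Equations

end LineAmoeba

/-! ### The theorem, by the number of ends. -/

theorem mainTheorem4 {n : ℕ} (ℓ : Set (LineAmoeba.Torus n)) (hℓ : LineAmoeba.IsLine ℓ) :
    -- the affine subtorus of dimension one less than the number of ends that contains the line
    (∃ d : ℕ, d + 1 = (LineAmoeba.ends ℓ).ncard ∧
      LineAmoeba.IsAffineSubtorus (LineAmoeba.affineTorus ℓ) d ∧
      ℓ ⊆ LineAmoeba.affineTorus ℓ) ∧
    -- two ends
    ((LineAmoeba.ends ℓ).ncard = 2 →
      ℓ = LineAmoeba.affineTorus ℓ ∧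
      LineAmoeba.IsRationalAffineLine (LineAmoeba.algAmoeba ℓ)) ∧
    -- three ends
    ((LineAmoeba.ends ℓ).ncard = 3 →
      (∀ (T : Set (LineAmoeba.Torus n)) (d : ℕ), LineAmoeba.IsAffineSubtorus T d →
        ℓ ⊆ T → T ⊆ LineAmoeba.affineTorus ℓ → T = LineAmoeba.affineTorus ℓ) ∧
      ∀ ι : LineAmoeba.ends ℓ → Fin (n + 1), LineAmoeba.IsEndCoordinate ℓ ι →
        ∀ e f g : LineAmoeba.ends ℓ, e ≠ f → e ≠ g → f ≠ g →
          ∃ a b c : ℂ, a ≠ 0 ∧ b ≠ 0 ∧ c ≠ 0 ∧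
            ℓ = {x ∈ LineAmoeba.affineTorus ℓ |
              a * LineAmoeba.hom x (ι e) + b * LineAmoeba.hom x (ι f) +
                c * LineAmoeba.hom x (ι g) = 0} ∧
            LineAmoeba.algAmoeba ℓ =
              {r ∈ LineAmoeba.algAmoeba (LineAmoeba.affineTorus ℓ) |
                LineAmoeba.TriangleIneq (‖a‖ * LineAmoeba.homReal r (ι e))
                  (‖b‖ * LineAmoeba.homReal r (ι f)) (‖c‖ * LineAmoeba.homReal r (ι g))}) ∧
    -- at least four ends
    (4 ≤ (LineAmoeba.ends ℓ).ncard →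
      -- the map to the algebraic amoeba
      (LineAmoeba.IsComplexLine ℓ →
        Set.BijOn LineAmoeba.absMap ℓ (LineAmoeba.algAmoeba ℓ)) ∧
      (∀ C : Set (LineAmoeba.PSpace n), LineAmoeba.IsCircle ℓ C → LineAmoeba.ends ℓ ⊆ C →
        Set.InjOn LineAmoeba.absMap {x ∈ ℓ | LineAmoeba.toP x ∈ C} ∧
        ∀ x ∈ ℓ, LineAmoeba.toP x ∉ C →
          {y ∈ ℓ | LineAmoeba.absMap y = LineAmoeba.absMap x}.ncard = 2 ∧
          ∀ y ∈ ℓ, LineAmoeba.absMap y = LineAmoeba.absMap x → LineAmoeba.toP y ∉ C) ∧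
      -- equations and inequalities, real case
      (LineAmoeba.IsRealLine ℓ →
        ∀ ι : LineAmoeba.ends ℓ → Fin (n + 1), LineAmoeba.IsEndCoordinate ℓ ι →
          ∃ Q : LineAmoeba.FourEnds ℓ → MvPolynomial (Fin (n + 1)) ℝ,
            (∀ F, (Q F).IsHomogeneous 2 ∧ (Q F).vars = F.1.image ι) ∧
            Nonempty (ChartedSpace (EuclideanSpace ℝ (Fin 2)) (LineAmoeba.cutOut ℓ Q)) ∧
            LineAmoeba.algAmoeba ℓ =
              {r ∈ LineAmoeba.cutOut ℓ Q | LineAmoeba.PlanarInequalities ℓ ι r}) ∧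
      -- equations, complex case
      (LineAmoeba.IsComplexLine ℓ →
        (∃ F : LineAmoeba.FourEnds ℓ, ¬ LineAmoeba.Concyclic F) ∧
        ∀ ι : LineAmoeba.ends ℓ → Fin (n + 1), LineAmoeba.IsEndCoordinate ℓ ι →
          ∀ F₀ : LineAmoeba.FourEnds ℓ, ¬ LineAmoeba.Concyclic F₀ →
            ∃ Q : LineAmoeba.FourEnds ℓ → MvPolynomial (Fin (n + 1)) ℝ,
              (∀ F, Q F ≠ 0 ∧ ((Q F).vars : Set (Fin (n + 1))) ⊆ Set.range ι ∧
                (LineAmoeba.Concyclic F → (Q F).IsHomogeneous 2) ∧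
                (¬ LineAmoeba.Concyclic F → (Q F).IsHomogeneous 4)) ∧
              (∀ F, F ≠ F₀ → (Q F).vars = F.1.image ι) ∧
              LineAmoeba.algAmoeba ℓ = LineAmoeba.cutOut ℓ Q)) := by
  have hfin := hℓ.finite_ends
  have hft := Fintype.ofFinite (LineAmoeba.ends ℓ)
  have hcard : (LineAmoeba.ends ℓ).ncard = Fintype.card (LineAmoeba.ends ℓ) := by
    rw [← Nat.card_coe_set_eq, Nat.card_eq_fintype_card]
  refine ⟨hℓ.isAffineSubtorus, fun h2 => ?_, fun h3 => ?_, fun h4 => ?_⟩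
  · classical
    obtain ⟨e, he⟩ := Finset.card_eq_one.1 (by
      rw [Finset.card_erase_of_mem (Finset.mem_univ (hℓ.endOf 0)), Finset.card_univ, ← hcard, h2] :
        (Finset.univ.erase (hℓ.endOf 0)).card = 1)
    have hne : e ≠ hℓ.endOf 0 := Finset.ne_of_mem_erase (he ▸ Finset.mem_singleton_self e)
    have hall : ∀ f, f = hℓ.endOf 0 ∨ f = e := fun f => by
      by_cases hf : f = hℓ.endOf 0
      · exact Or.inl hf
      · exact Or.inr (Finset.mem_singleton.1 (he ▸ Finset.mem_erase.2 ⟨hf, Finset.mem_univ f⟩))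
    exact ⟨hℓ.eq_affineTorus_of_two hne.symm hall, hℓ.isRationalAffineLine_of_two hne hall⟩
  · classical
    have hall : ∀ {e f g : LineAmoeba.ends ℓ}, e ≠ f → e ≠ g → f ≠ g →
        ∀ x, x = e ∨ x = f ∨ x = g := by
      intro e f g hef heg hfg x
      have : ({e, f, g} : Finset (LineAmoeba.ends ℓ)) = Finset.univ := by
        rw [← Finset.card_eq_iff_eq_univ, ← hcard, h3]
        exact Finset.card_eq_three.2 ⟨e, f, g, hef, heg, hfg, rfl⟩
      simpa using this.symm.subset (Finset.mem_univ x)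
    refine ⟨fun T d hT hℓT hTa => ?_, fun ι hι e f g hef heg hfg => ?_⟩
    -- The chart is taken with the end of x₀ at ∞, which makes x₀ constant for t = 1.
    · obtain ⟨e, f, hef, hset⟩ := Finset.card_eq_two.1 (by
        rw [Finset.card_erase_of_mem (Finset.mem_univ (hℓ.endOf 0)), Finset.card_univ, ← hcard, h3] :
          (Finset.univ.erase (hℓ.endOf 0)).card = 2)
      have hmem : ∀ x ∈ ({e, f} : Finset (LineAmoeba.ends ℓ)), hℓ.endOf 0 ≠ x := fun x hx =>
        (Finset.ne_of_mem_erase (hset.symm.subset hx)).symm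
      have he := hmem e (by simp)
      have hf := hmem f (by simp)
      obtain ⟨c⟩ := hℓ.nonempty_chart he hf hef
      exact hℓ.minimal_of_three c rfl (hall he hf hef) hT hℓT hTa
    · obtain ⟨c⟩ := hℓ.nonempty_chart hef heg hfg
      exact hℓ.three_ends c hι (hall hef heg hfg)
  · obtain ⟨e₁, e₂, e₃, ⟨c⟩⟩ := hℓ.exists_three_ends (by omega)
    refine ⟨fun hc => (c.injOn_of_isComplexLine hℓ hc).bijOn_image, fun C hC hE => ?_,
      fun hr ι hι => ?_,
      fun hc => ⟨c.exists_not_concyclic hc, fun ι hι F₀ hF₀ => hℓ.exists_equations hι hF₀⟩⟩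
    · obtain rfl := c.eq_circle hC (hE e₁.2) (hE e₂.2) (hE e₃.2)
      exact ⟨c.injOn_circle hℓ, fun x hx hxc => c.fibre_of_real hℓ hE hx hxc⟩
    · obtain ⟨C, hC, hE⟩ := hr
      choose k hk hrel using fun F : LineAmoeba.FourEnds ℓ =>
        hℓ.exists_relation hι ⟨C, hC, fun e _ => hE e.2⟩
      exact ⟨_, fun F => ⟨LineAmoeba.isHomogeneous_diagForm _ _ _,
        LineAmoeba.vars_diagForm (hℓ.endCoordinate_injective hι) (hk F)⟩,
        hℓ.nonempty_chartedSpace hι c hk hrel, hℓ.algAmoeba_eq_of_relations hι c hk hrel⟩
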